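/- **Setting.** Let $L,M,\mu>0$, $E_B<0$, $\kappa=2\pi/L$, $\widetilde\mu=\mu/|E_B|$, and let sums over $k,l$ run over $\kappa\mathbb Z^2$ with the indicated restrictions. Let $\Omega=[-L/2,L/2]^2$ with periodic boundary conditions, $\mathscr H_n=\bigwedge^n L^2(\Omega)$, let $a_k,a_k^*$ be the fermionic annihilation and creation operators of the plane waves $\varphi_k(x)=L^{-1}e^{ikx}$, and put $P_{\rm f}=\sum_k k\,a_k^*a_k$, $T=\sum_k k^2a_k^*a_k$. Let $$N(\mu)=|\{k\in\kappa\mathbb Z^2:k^2\le\mu\}|,\qquad E_0(\mu)=\sum_{k^2\le\mu}k^2,$$ $$G(q,\tau)=\frac1{L^2}\sum_k\Big(\frac1{(1+\frac1M)k^2-E_B}-\frac{\chi_{(\mu,\infty)}(k^2)}{\frac1M(q-k)^2+k^2+\tau}\Big)\qquad(q\in\kappa\mathbb Z^2,\ \tau>-\mu),$$ and let $e_{\rm P}(\mu,E_B)<0$ be the lowest solution of $$e=-\frac1{L^2}\sum_{k^2\le\mu}\frac1{G(k,-k^2-e)}.$$ For $p\in\kappa\mathbb Z^2$ and $\varepsilon>0$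 let $$P_p(\lambda)=\frac1{L^2}\sum_{k^2,l^2>\mu}a_l^*\,\frac1{\frac1M(p-P_{\rm f}-k-l)^2+T+k^2+l^2-\lambda}\,a_k,$$ $$K(\varepsilon,\widetilde\mu)=\varepsilon^{-1/2}\big(\varepsilon^{-1/2}+\sqrt{\log\widetilde\mu}+\varepsilon\log\widetilde\mu\big).$$ Let $\Pi_\varepsilon$ be the orthogonal projection in $\mathscr H_{N(\mu)-1}$ onto the closed span of those antisymmetric products of plane waves all of whose momenta satisfy $k^2\le\big(1+\frac1{\varepsilon\log\widetilde\mu}\big)\mu$, let $\Pi_\varepsilon^\perp=1-\Pi_\varepsilon$, and let $$\Psi_p(\lambda,\varepsilon)=\Pi_\varepsilon^\perp\big(G(p-P_{\rm f},T-\lambda)+P_p(\lambda)-K(\varepsilon,\widetilde\mu)\big)\Pi_\varepsilon^\perp,$$ the closure of the operator given by this formula on the finite linear combinations of antisymmetric products of $N(\mu)-1$ plane waves. **Corollary (stability at positive density).** Let $M>1.225$. There is $\varepsilon_0>0$ (depending only on $M$) such that for every $\varepsilon\in(0,\varepsilon_0)$ there is $c_0>0$ (depending only on $M$ and $\varepsilon$)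 with the following property: for all $L,\mu>0$ and $E_B<0$ with $L^2|E_B|\ge1$ and $\mu/|E_B|\ge c_0$, all real $\lambda\le E_0(\mu)+e_{\rm P}(\mu,E_B)$ and all $p\in\kappa\mathbb Z^2$, $$\Psi_p(\lambda,\varepsilon)\ge0\quad\text{on }\mathscr H_{N(\mu)-1}.$$ -/

import Mathlib

open scoped InnerProductSpace

noncomputable section

namespace FermiPolaron

/-! ## Momenta -/

/-- Integer labels `z` of the momentum lattice `κ ℤ²`. -/
abbrev Lattice : Type := Fin 2 → ℤ

/-- Momenta in `ℝ²` with the Euclidean norm. -/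
abbrev Plane : Type := EuclideanSpace ℝ (Fin 2)

/-- The momentum `κ z`, `κ = 2π / L`, with integer label `z`. -/
def mom (L : ℝ) (z : Lattice) : Plane :=
  WithLp.toLp 2 fun i => 2 * Real.pi / L * (z i : ℝ)

/-! ## The fermionic `n`-particle space

The plane waves `φ_k(x) = L⁻¹ exp(i k x)`, `k ∈ κ ℤ²`, are an orthonormal basis of `L²(Ω)`,
`Ω = [-L/2, L/2]²` with periodic boundary conditions. An `n`-particle wave function is given by its
Fourier coefficients `w(k₁, …, kₙ)` in this basis, a square summable function of `n` momenta; it is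
fermionic if it is antisymmetric. -/

/-- `n` momentum labels. -/
abbrev Config (n : ℕ) : Type := Fin n → Lattice

/-- Square summable functions of `n` momenta: `L²(Ω)^{⊗ n}` in Fourier space. -/
abbrev Wave (n : ℕ) : Type := lp (fun _ : Config n => ℂ) 2

/-- Antisymmetry under permutations of the particles. -/
def IsAntisymm {n : ℕ} (w : Config n → ℂ) : Prop :=
  ∀ (σ : Equiv.Perm (Fin n)) (c : Config n),
    w (fun i => c (σ i)) = ((Equiv.Perm.sign σ : ℤ) : ℂ) * w c

/-- The Hilbert space `ℋₙ = ⋀ⁿ L²(Ω)` of antisymmetric `n`-particle wave functions. -/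
def Fermi (n : ℕ) : Submodule ℂ (Wave n) where
  carrier := {w | IsAntisymm (w : Config n → ℂ)}
  zero_mem' := by
    intro σ c
    simp
  add_mem' := by
    intro a b ha hb σ c
    simp only [lp.coeFn_add, Pi.add_apply]
    rw [ha σ c, hb σ c]
    ring
  smul_mem' := by
    intro r a ha σ c
    simp only [lp.coeFn_smul, Pi.smul_apply, smul_eq_mul]
    rw [ha σ c]
    ring

theorem isClosed_fermi (n : ℕ) : IsClosed (Fermi n : Set (Wave n)) := by
  have hc : ∀ c : Config n, Continuous fun w : Wave n => w c := fun c =>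
    (lp.lipschitzWith_one_eval 2 c).continuous
  have : (Fermi n : Set (Wave n)) = ⋂ (σ : Equiv.Perm (Fin n)) (c : Config n),
      {w : Wave n | w (fun i => c (σ i)) = ((Equiv.Perm.sign σ : ℤ) : ℂ) * w c} := by
    ext w
    simp only [Set.mem_iInter]
    rfl
  rw [this]
  exact isClosed_iInter fun σ => isClosed_iInter fun c =>
    isClosed_eq (hc _) (continuous_const.mul (hc _))

instance (n : ℕ) : CompleteSpace (Fermi n) :=
  (isClosed_fermi n).completeSpace_coe

/-- The value `w(k₁, …, kₙ)`. -/
def coeff {n : ℕ} (w : Fermi n) : Config n → ℂ := ((w : Wave n) : Config n → ℂ)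

theorem coeff_add {n : ℕ} (v w : Fermi n) : coeff (v + w) = coeff v + coeff w := rfl

theorem coeff_smul {n : ℕ} (r : ℂ) (w : Fermi n) : coeff (r • w) = r • coeff w := rfl

theorem coeff_zero {n : ℕ} : coeff (0 : Fermi n) = 0 := rfl

theorem coeff_ext {n : ℕ} {v w : Fermi n} (h : coeff v = coeff w) : v = w :=
  Subtype.ext (lp.ext h)

theorem coeff_antisymm {n : ℕ} (w : Fermi n) : IsAntisymm (coeff w) := w.2

theorem coeff_memℓp {n : ℕ} (w : Fermi n) : Memℓp (coeff w) 2 := lp.memℓp (w : Wave n)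

/-- An antisymmetric square summable function as an element of `ℋₙ`. -/
def mkFermi {n : ℕ} (f : Config n → ℂ) (hf : Memℓp f 2) (ha : IsAntisymm f) : Fermi n :=
  ⟨⟨f, hf⟩, ha⟩

@[simp] theorem coeff_mkFermi {n : ℕ} (f : Config n → ℂ) (hf : Memℓp f 2) (ha : IsAntisymm f) :
    coeff (mkFermi f hf ha) = f := rfl

theorem hasSum_norm_sq {n : ℕ} (w : Fermi n) :
    HasSum (fun c => ‖coeff w c‖ ^ 2) (‖w‖ ^ 2) := by
  have h := lp.hasSum_norm (p := 2) (by norm_num) (w : Wave n)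
  simpa [coeff] using h

theorem memℓp_two_of_summable {ι : Type*} {f : ι → ℂ} (h : Summable fun c => ‖f c‖ ^ 2) :
    Memℓp f 2 := by
  apply memℓp_gen
  simpa using h

theorem snoc_comp_injective {n : ℕ} (k : Lattice) :
    Function.Injective fun c : Config n => (Fin.snoc c k : Config (n + 1)) := by
  intro c d h
  exact (Fin.snoc_injective2 h).1

theorem summable_annih {n : ℕ} (k : Lattice) (w : Fermi (n + 1)) :
    Summable fun c : Config n =>
      ‖((Real.sqrt (n + 1) : ℝ) : ℂ) * coeff w (Fin.snoc c k)‖ ^ 2 := by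
  have h := ((hasSum_norm_sq w).summable.comp_injective (snoc_comp_injective k)).mul_left
    (Real.sqrt (n + 1) ^ 2)
  refine h.congr fun c => ?_
  simp [mul_pow]

theorem isAntisymm_annih {n : ℕ} (k : Lattice) {f : Config (n + 1) → ℂ} (hf : IsAntisymm f)
    (r : ℂ) : IsAntisymm fun c : Config n => r * f (Fin.snoc c k) := by
  intro σ c
  have h := hf (σ.viaFintypeEmbedding Fin.castSuccEmb) (Fin.snoc c k)
  rw [Equiv.Perm.viaFintypeEmbedding_sign] at h
  have e : (fun i => (Fin.snoc c k : Config (n + 1))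
      (σ.viaFintypeEmbedding Fin.castSuccEmb i)) =
      Fin.snoc (fun i => c (σ i)) k := by
    funext i
    refine Fin.lastCases ?_ (fun j => ?_) i
    · rw [Equiv.Perm.viaFintypeEmbedding_apply_notMem_range]
      · simp
      · simp
    · have := Equiv.Perm.viaFintypeEmbedding_apply_image σ
        (Fin.castSuccEmb (n := n)) j
      simp only [Fin.coe_castSuccEmb] at this
      rw [this]
      simp
  rw [e] at h
  simp only [h]
  ring

/-! ## Creation and annihilation operators -/

/-- The annihilation operator as a linear map. -/
def annihLin {n : ℕ} (k : Lattice) : Fermi (n + 1) →ₗ[ℂ] Fermi n where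
  toFun w := mkFermi (fun c => ((Real.sqrt (n + 1) : ℝ) : ℂ) * coeff w (Fin.snoc c k))
    (memℓp_two_of_summable (summable_annih k w)) (isAntisymm_annih k (coeff_antisymm w) _)
  map_add' v w := by
    apply coeff_ext
    funext c
    simp [coeff_add, mul_add]
  map_smul' r w := by
    apply coeff_ext
    funext c
    simp only [coeff_mkFermi, coeff_smul, Pi.smul_apply, smul_eq_mul, RingHom.id_apply]
    ring

theorem sum_norm_annihLin_sq {n : ℕ} (w : Fermi (n + 1)) (F : Finset Lattice) :
    ∑ k ∈ F, ‖annihLin k w‖ ^ 2 ≤ (n + 1) * ‖w‖ ^ 2 := by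
  have h1 : Summable fun q : Lattice × Config n =>
      ‖coeff w (Fin.snoc q.2 q.1 : Config (n + 1))‖ ^ 2 :=
    (hasSum_norm_sq w).summable.comp_injective (i := fun q : Lattice × Config n =>
      (Fin.snoc q.2 q.1 : Config (n + 1))) (by
        intro a b h
        have := Fin.snoc_injective2 h
        exact Prod.ext this.2 this.1)
  have h2 : ∑' q : Lattice × Config n, ‖coeff w (Fin.snoc q.2 q.1 : Config (n + 1))‖ ^ 2
      ≤ ‖w‖ ^ 2 := by
    rw [← (hasSum_norm_sq w).tsum_eq]
    refine Summable.tsum_le_tsum_of_inj (fun q : Lattice × Config n =>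
      (Fin.snoc q.2 q.1 : Config (n + 1))) ?_ (fun _ _ => by positivity) (fun _ => le_rfl) h1
      (hasSum_norm_sq w).summable
    intro a b h
    have := Fin.snoc_injective2 h
    exact Prod.ext this.2 this.1
  have h3 : ∀ k : Lattice, ‖annihLin k w‖ ^ 2 =
      (n + 1) * ∑' c : Config n, ‖coeff w (Fin.snoc c k : Config (n + 1))‖ ^ 2 := by
    intro k
    rw [← (hasSum_norm_sq (annihLin k w)).tsum_eq, ← tsum_mul_left]
    congr 1
    funext c
    have h4 : (0 : ℝ) ≤ (n : ℝ) + 1 := by positivity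
    simp [annihLin, mul_pow, Real.sq_sqrt h4]
  simp only [h3]
  rw [← Finset.mul_sum]
  refine mul_le_mul_of_nonneg_left ?_ (by positivity)
  refine le_trans ?_ h2
  rw [h1.tsum_prod]
  exact h1.prod.sum_le_tsum F fun k _ => tsum_nonneg fun c => by positivity

/-- The annihilation operator `a_k`, `(a_k w)(k₁, …, kₙ) = √(n+1) w(k₁, …, kₙ, k)`. -/
def annih {n : ℕ} (k : Lattice) : Fermi (n + 1) →L[ℂ] Fermi n :=
  (annihLin k).mkContinuous (Real.sqrt (n + 1)) fun w => by
    have h := sum_norm_annihLin_sq w {k}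
    rw [Finset.sum_singleton] at h
    refine le_of_sq_le_sq ?_ (by positivity)
    rw [mul_pow, Real.sq_sqrt (by positivity)]
    exact h

/-- The creation operator `a_k^*`, the adjoint of `a_k`. -/
def create {n : ℕ} (k : Lattice) : Fermi n →L[ℂ] Fermi (n + 1) :=
  ContinuousLinearMap.adjoint (annih k)

theorem norm_sum_create_sq_le {n : ℕ} (F : Finset Lattice) (y : Lattice → Fermi n) :
    ‖∑ l ∈ F, create l (y l)‖ ^ 2 ≤ (n + 1) * ∑ l ∈ F, ‖y l‖ ^ 2 := by
  set x := ∑ l ∈ F, create l (y l) with hx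
  have h1 : ‖x‖ ^ 2 ≤ ∑ l ∈ F, ‖annih l x‖ * ‖y l‖ := by
    have e : ‖x‖ ^ 2 = RCLike.re ⟪x, x⟫_ℂ := (inner_self_eq_norm_sq (𝕜 := ℂ) x).symm
    have e2 : ⟪x, x⟫_ℂ = ∑ l ∈ F, ⟪annih l x, y l⟫_ℂ := by
      conv_lhs => rw [hx, inner_sum]
      refine Finset.sum_congr rfl fun l _ => ?_
      rw [create, ContinuousLinearMap.adjoint_inner_right]
    rw [e, e2, map_sum]
    exact Finset.sum_le_sum fun l _ => re_inner_le_norm (𝕜 := ℂ) (annih l x) (y l)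
  have h2 := Finset.sum_mul_sq_le_sq_mul_sq F (fun l => ‖annih l x‖) (fun l => ‖y l‖)
  have h3 : ∑ l ∈ F, ‖annih l x‖ ^ 2 ≤ (n + 1) * ‖x‖ ^ 2 := sum_norm_annihLin_sq x F
  have h4 : (‖x‖ ^ 2) ^ 2 ≤ ((n + 1) * ‖x‖ ^ 2) * ∑ l ∈ F, ‖y l‖ ^ 2 :=
    calc (‖x‖ ^ 2) ^ 2 ≤ (∑ l ∈ F, ‖annih l x‖ * ‖y l‖) ^ 2 :=
          pow_le_pow_left₀ (by positivity) h1 2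
      _ ≤ _ := h2
      _ ≤ _ := mul_le_mul_of_nonneg_right h3 (Finset.sum_nonneg fun _ _ => by positivity)
  rcases (sq_nonneg ‖x‖).eq_or_lt with h0 | h0
  · rw [← h0]
    exact mul_nonneg (by positivity) (Finset.sum_nonneg fun _ _ => by positivity)
  · nlinarith

theorem summable_create {n : ℕ} {y : Lattice → Fermi n} (hy : Summable fun l => ‖y l‖ ^ 2) :
    Summable fun l => create l (y l) := by
  rw [summable_iff_vanishing_norm]
  intro ε hε
  obtain ⟨s, hs⟩ := summable_iff_vanishing_norm.1 hy (ε ^ 2 / (n + 1)) (by positivity)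
  refine ⟨s, fun t ht => ?_⟩
  have h1 := hs t ht
  have h2 := norm_sum_create_sq_le t y
  have h3 : ∑ l ∈ t, ‖y l‖ ^ 2 < ε ^ 2 / (n + 1) := lt_of_le_of_lt (le_abs_self _) h1
  rw [lt_div_iff₀ (by positivity)] at h3
  exact lt_of_pow_lt_pow_left₀ 2 hε.le (by linarith)

/-! ## Finite linear combinations of plane wave products and functions of `P_f`, `T` -/

/-- All finite linear combinations of the states `φ_{k₁} ∧ ⋯ ∧ φ_{kₙ}`: the wave functions with
finitely many nonzero Fourier coefficients. -/
def finDom (n : ℕ) : Submodule ℂ (Fermi n) where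
  carrier := {w | (Function.support (coeff w)).Finite}
  zero_mem' := by
    change (Function.support (coeff 0)).Finite
    simp [coeff_zero]
  add_mem' := by
    intro a b ha hb
    refine (ha.union hb).subset ?_
    rw [coeff_add]
    exact Function.support_add _ _
  smul_mem' := by
    intro r a ha
    refine ha.subset ?_
    rw [coeff_smul]
    exact Function.support_const_smul_subset _ _

theorem memℓp_of_finite {ι : Type*} {f : ι → ℂ} (h : (Function.support f).Finite) :
    Memℓp f 2 :=
  (memℓp_zero h).of_exponent_ge (by simp)

/-- Multiplication by a permutation invariant real function of the momenta. -/
def mulFin {n : ℕ} (m : Config n → ℝ)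
    (hm : ∀ (σ : Equiv.Perm (Fin n)) (c : Config n), m (fun i => c (σ i)) = m c) :
    finDom n →ₗ[ℂ] finDom n where
  toFun w := ⟨mkFermi (fun c => (m c : ℂ) * coeff (w : Fermi n) c)
      (memℓp_of_finite (w.2.subset (Function.support_mul_subset_right _ _)))
      (by
        intro σ c
        simp only
        rw [hm σ c, coeff_antisymm (w : Fermi n) σ c]
        ring),
    w.2.subset (Function.support_mul_subset_right _ _)⟩
  map_add' v w := by
    apply Subtype.ext
    apply coeff_ext
    funext c
    exact mul_add (m c : ℂ) (coeff (v : Fermi n) c) (coeff (w : Fermi n) c)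
  map_smul' r w := by
    apply Subtype.ext
    apply coeff_ext
    funext c
    exact mul_left_comm (m c : ℂ) r (coeff (w : Fermi n) c)

/-- The eigenvalue `k₁ + ⋯ + kₙ` of the total fermion momentum `P_f`. -/
def totalMom (L : ℝ) {n : ℕ} (c : Config n) : Plane := ∑ i, mom L (c i)

/-- The eigenvalue `k₁² + ⋯ + kₙ²` of the kinetic energy `T`. -/
def kinetic (L : ℝ) {n : ℕ} (c : Config n) : ℝ := ∑ i, ‖mom L (c i)‖ ^ 2

/-- The operator `f(P_f, T)`, `(f(P_f, T) w)(c) = f(k₁ + ⋯ + kₙ, k₁² + ⋯ + kₙ²) w(c)`. -/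
def funPT (L : ℝ) {n : ℕ} (f : Plane → ℝ → ℝ) : finDom n →ₗ[ℂ] finDom n :=
  mulFin (fun c => f (totalMom L c) (kinetic L c)) (by
    intro σ c
    have h1 : totalMom L (fun i => c (σ i)) = totalMom L c :=
      Equiv.sum_comp σ fun i => mom L (c i)
    have h2 : kinetic L (fun i => c (σ i)) = kinetic L c :=
      Equiv.sum_comp σ fun i => ‖mom L (c i)‖ ^ 2
    simp only [h1, h2])

/-- `a_k` on finite linear combinations of plane wave products. -/
def annihFin {n : ℕ} (k : Lattice) : finDom (n + 1) →ₗ[ℂ] finDom n where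
  toFun w := ⟨annih k (w : Fermi (n + 1)), by
    have h := w.2.preimage ((snoc_comp_injective (n := n) k).injOn)
    refine h.subset ?_
    exact Function.support_mul_subset_right _ _⟩
  map_add' v w := by
    apply Subtype.ext
    simp
  map_smul' r w := by
    apply Subtype.ext
    simp

/-! ## The model -/

/-- Box length `L`, mass ratio `M`, chemical potential `μ` and binding energy `E_B`. -/
structure Model where
  L : ℝ
  M : ℝ
  mu : ℝ
  EB : ℝ
  L_pos : 0 < L
  M_pos : 0 < M
  mu_pos : 0 < mu
  EB_neg : EB < 0

namespace Model

variable (S : Model)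

/-- The momentum with label `z`. -/
abbrev k (z : Lattice) : Plane := mom S.L z

/-- Hole momenta, `k² ≤ μ`. -/
def holes : Set Lattice := {z | ‖S.k z‖ ^ 2 ≤ S.mu}

/-- Particle momenta, `k² > μ`. -/
def particles : Set Lattice := {z | S.mu < ‖S.k z‖ ^ 2}

/-- The particle number `N(μ)`. -/
def N : ℕ := S.holes.ncard

/-- The energy `E₀(μ)` of the Fermi sea. -/
def E0 : ℝ := ∑ᶠ z ∈ S.holes, ‖S.k z‖ ^ 2

open Classical in
/-- `G(q, τ) = L⁻² ∑_k (1 / ((1 + 1/M) k² - E_B) - χ_{(μ,∞)}(k²) / ((q - k)² / M + k² + τ))`. -/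
def G (q : Plane) (τ : ℝ) : ℝ :=
  1 / S.L ^ 2 * ∑' z : Lattice,
    (1 / ((1 + 1 / S.M) * ‖S.k z‖ ^ 2 - S.EB) -
      if S.mu < ‖S.k z‖ ^ 2 then 1 / (1 / S.M * ‖q - S.k z‖ ^ 2 + ‖S.k z‖ ^ 2 + τ) else 0)

/-- The negative solutions of the polaron equation `e = - L⁻² ∑_{k² ≤ μ} 1 / G(k, -k² - e)`. -/
def polaronSolutions : Set ℝ :=
  {e | e < 0 ∧ (∀ z ∈ S.holes, S.G (S.k z) (-‖S.k z‖ ^ 2 - e) ≠ 0) ∧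
    e = -(1 / S.L ^ 2 * ∑ᶠ z ∈ S.holes, 1 / S.G (S.k z) (-‖S.k z‖ ^ 2 - e))}

/-- The polaron energy `e_P(μ, E_B)`, the lowest solution of the polaron equation. -/
def eP : ℝ := sInf S.polaronSolutions

/-- `μ̃ = μ / |E_B|`. -/
def muTilde : ℝ := S.mu / |S.EB|

/-- `K(ε, μ̃) = ε^{-1/2} (ε^{-1/2} + √(log μ̃) + ε log μ̃)`. -/
def K (ε : ℝ) : ℝ :=
  1 / √ε * (1 / √ε + √(Real.log S.muTilde) + ε * Real.log S.muTilde)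

/-- The multiplier `1 / ((p - P - k - l)² / M + T + k² + l² - λ)`, as a function of `P` and `T`. -/
def resolvent (lam : ℝ) (p k l : Lattice) (P : Plane) (T : ℝ) : ℝ :=
  1 / (1 / S.M * ‖S.k p - P - S.k k - S.k l‖ ^ 2 + T + ‖S.k k‖ ^ 2 + ‖S.k l‖ ^ 2 - lam)

/-- The summand `a_l^* ((p - P_f - k - l)² / M + T + k² + l² - λ)⁻¹ a_k`. -/
def Pterm {n : ℕ} (lam : ℝ) (p k l : Lattice) : finDom (n + 1) →ₗ[ℂ] Fermi (n + 1) :=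
  (create l).toLinearMap ∘ₗ (finDom n).subtype ∘ₗ funPT S.L (S.resolvent lam p k l) ∘ₗ annihFin k

theorem sup_norm_le (z : Lattice) : ‖z‖ ≤ ‖S.k z‖ * (S.L / (2 * Real.pi)) := by
  have hL := S.L_pos
  have hpi := Real.pi_pos
  rw [pi_norm_le_iff_of_nonneg (by positivity)]
  intro i
  have h := PiLp.norm_apply_le (S.k z) i
  have e : (S.k z) i = 2 * Real.pi / S.L * (z i : ℝ) := rfl
  rw [e, norm_mul, Real.norm_of_nonneg (by positivity)] at h
  have e2 : ‖(z i : ℝ)‖ = ‖z i‖ := Int.norm_cast_real _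
  rw [e2] at h
  calc ‖z i‖ = (2 * Real.pi / S.L * ‖z i‖) * (S.L / (2 * Real.pi)) := by field_simp
    _ ≤ _ := mul_le_mul_of_nonneg_right h (by positivity)

theorem eventually_resolvent_le (lam : ℝ) (p k : Lattice) :
    ∃ C : ℝ, ∀ᶠ l : Lattice in Filter.cofinite, ∀ (P : Plane) (T : ℝ), 0 ≤ T →
      |S.resolvent lam p k l P T| ≤ C / ‖l‖ ^ 2 := by
  have hL := S.L_pos
  have hM := S.M_pos
  have hpi := Real.pi_pos
  set r : ℝ := S.L / (2 * Real.pi) with hr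
  have hr0 : 0 < r := by positivity
  refine ⟨2 * r ^ 2, ?_⟩
  have h1 : Filter.Tendsto (fun l : Lattice => ‖l‖) Filter.cofinite Filter.atTop := by
    rw [← Filter.cocompact_eq_cofinite]
    exact tendsto_norm_cocompact_atTop
  filter_upwards [h1.eventually_ge_atTop (max 1 (2 * r ^ 2 * |lam|))] with l hl P T hT
  have hl1 : 1 ≤ ‖l‖ := (le_max_left _ _).trans hl
  have hl2 : 2 * r ^ 2 * |lam| ≤ ‖l‖ ^ 2 := by
    have := (le_max_right _ _).trans hl
    nlinarith
  have hk : ‖l‖ ^ 2 ≤ ‖S.k l‖ ^ 2 * r ^ 2 := by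
    rw [← mul_pow]
    exact pow_le_pow_left₀ (norm_nonneg _) (S.sup_norm_le l) 2
  have hden : ‖l‖ ^ 2 / (2 * r ^ 2) ≤
      1 / S.M * ‖S.k p - P - S.k k - S.k l‖ ^ 2 + T + ‖S.k k‖ ^ 2 + ‖S.k l‖ ^ 2 - lam := by
    have a1 : 0 ≤ 1 / S.M * ‖S.k p - P - S.k k - S.k l‖ ^ 2 := by positivity
    have a2 : 0 ≤ ‖S.k k‖ ^ 2 := by positivity
    have a3 : |lam| ≤ ‖l‖ ^ 2 / (2 * r ^ 2) := by
      rw [le_div_iff₀ (by positivity)]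
      linarith
    have a4 : ‖l‖ ^ 2 / r ^ 2 ≤ ‖S.k l‖ ^ 2 := by
      rw [div_le_iff₀ (by positivity)]
      exact hk
    have a5 : ‖l‖ ^ 2 / r ^ 2 = ‖l‖ ^ 2 / (2 * r ^ 2) + ‖l‖ ^ 2 / (2 * r ^ 2) := by
      field_simp
      norm_num
    have a6 := le_abs_self lam
    linarith
  have hpos : 0 < ‖l‖ ^ 2 / (2 * r ^ 2) := by positivity
  rw [resolvent, abs_of_nonneg (by positivity [hpos.trans_le hden])]
  calc _ ≤ 1 / (‖l‖ ^ 2 / (2 * r ^ 2)) := one_div_le_one_div_of_le hpos hden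
    _ = _ := by rw [one_div_div]

theorem norm_funPT_le {n : ℕ} (f : Plane → ℝ → ℝ) (B : ℝ)
    (hf : ∀ P T, 0 ≤ T → |f P T| ≤ B) (u : finDom n) :
    ‖(funPT S.L f u : Fermi n)‖ ^ 2 ≤ B ^ 2 * ‖(u : Fermi n)‖ ^ 2 := by
  have h1 := hasSum_norm_sq (funPT S.L f u : Fermi n)
  have h2 := (hasSum_norm_sq (u : Fermi n)).mul_left (B ^ 2)
  refine hasSum_le (fun c => ?_) h1 h2
  have e : coeff (funPT S.L f u : Fermi n) c =
      (f (totalMom S.L c) (kinetic S.L c) : ℂ) * coeff (u : Fermi n) c := rfl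
  rw [e, norm_mul, mul_pow, Complex.norm_real, Real.norm_eq_abs]
  refine mul_le_mul_of_nonneg_right (pow_le_pow_left₀ (abs_nonneg _) (hf _ _ ?_) 2) (by positivity)
  exact Finset.sum_nonneg fun i _ => by positivity

theorem summable_Pterm_right {n : ℕ} (lam : ℝ) (p k : Lattice) (w : finDom (n + 1)) :
    Summable fun l => S.Pterm lam p k l w := by
  have : (fun l => S.Pterm lam p k l w) = fun l =>
      create l (funPT S.L (S.resolvent lam p k l) (annihFin k w) : Fermi n) := rfl
  rw [this]
  apply summable_create
  obtain ⟨C, hC⟩ := S.eventually_resolvent_le lam p k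
  have hs : Summable fun l : Lattice =>
      (C ^ 2 * ‖(annihFin k w : Fermi n)‖ ^ 2) * ‖l‖ ^ (-4 : ℝ) :=
    (EisensteinSeries.summable_one_div_norm_rpow (k := 4) (by norm_num)).mul_left _
  refine Summable.of_norm_bounded_eventually hs ?_
  filter_upwards [hC] with l hl
  have h := S.norm_funPT_le (S.resolvent lam p k l) _ (fun P T => hl P T) (annihFin k w)
  rw [Real.norm_of_nonneg (by positivity)]
  refine h.trans (le_of_eq ?_)
  rw [Real.rpow_neg (norm_nonneg _), show (4 : ℝ) = ((4 : ℕ) : ℝ) by norm_num, Real.rpow_natCast]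
  rw [div_pow, ← pow_mul]
  ring

theorem summable_Pterm {n : ℕ} (lam : ℝ) (p : Lattice) (w : finDom (n + 1)) :
    Summable fun q : S.particles × S.particles => S.Pterm lam p q.1 q.2 w := by
  have hfin : {k : Lattice | annihFin k w ≠ 0}.Finite := by
    refine (w.2.image fun c : Config (n + 1) => c (Fin.last n)).subset ?_
    intro k hk
    by_contra hcon
    apply hk
    apply Subtype.ext
    apply coeff_ext
    funext c
    have h0 : coeff (w : Fermi (n + 1)) (Fin.snoc c k) = 0 := by
      by_contra h
      exact hcon ⟨Fin.snoc c k, h, by simp⟩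
    change ((Real.sqrt (n + 1) : ℝ) : ℂ) * coeff (w : Fermi (n + 1)) (Fin.snoc c k) = 0
    rw [h0, mul_zero]
  have hall : Summable fun q : Lattice × Lattice => S.Pterm lam p q.1 q.2 w := by
    have h1 : ∀ k ∈ hfin.toFinset, Summable fun q : Lattice × Lattice =>
        Set.indicator (Set.range fun l => (k, l)) (fun q => S.Pterm lam p q.1 q.2 w) q := by
      intro k _
      have hinj : Function.Injective fun l : Lattice => (k, l) := Prod.mk_right_injective k
      rw [← hinj.summable_iff (fun x hx => Set.indicator_of_notMem hx _)]
      refine (S.summable_Pterm_right lam p k w).congr fun l => ?_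
      simp
    refine (summable_sum h1).congr fun q => ?_
    by_cases hq : q.1 ∈ hfin.toFinset
    · rw [Finset.sum_eq_single q.1]
      · exact Set.indicator_of_mem (Set.mem_range.2 ⟨q.2, rfl⟩) _
      · intro k _ hk
        apply Set.indicator_of_notMem
        rintro ⟨l, rfl⟩
        exact hk rfl
      · exact fun h => absurd hq h
    · have h0 : annihFin q.1 w = 0 := by simpa using hq
      rw [Finset.sum_eq_zero]
      · simp [Pterm, h0]
      · intro k hk
        apply Set.indicator_of_notMem
        rintro ⟨l, rfl⟩
        exact hq hk
  refine hall.comp_injective (i := fun q : S.particles × S.particles =>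
    ((q.1 : Lattice), (q.2 : Lattice))) ?_
  intro a b h
  simp only [Prod.mk.injEq] at h
  exact Prod.ext (Subtype.ext h.1) (Subtype.ext h.2)

/-- `P_p(λ) = L⁻² ∑_{k², l² > μ} a_l^* ((p - P_f - k - l)² / M + T + k² + l² - λ)⁻¹ a_k` on finite
linear combinations of plane wave products; the sum converges in `ℋₙ`. -/
def P (lam : ℝ) (p : Lattice) : (n : ℕ) → finDom n →ₗ[ℂ] Fermi n
  | 0 => 0
  | n + 1 =>
    { toFun := fun w => ((1 / S.L ^ 2 : ℝ) : ℂ) •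
        ∑' q : S.particles × S.particles, S.Pterm lam p q.1 q.2 w
      map_add' := fun v w => by
        simp only [map_add]
        rw [(S.summable_Pterm lam p v).tsum_add (S.summable_Pterm lam p w), smul_add]
      map_smul' := fun r w => by
        simp only [map_smul, RingHom.id_apply]
        rw [(S.summable_Pterm lam p w).tsum_const_smul, smul_comm] }

/-- Some momentum of `c` satisfies `k² > (1 + 1 / (ε log μ̃)) μ`. -/
def HasHighMode (ε : ℝ) {n : ℕ} (c : Config n) : Prop :=
  ∃ i, (1 + 1 / (ε * Real.log S.muTilde)) * S.mu < ‖S.k (c i)‖ ^ 2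

open Classical in
theorem isAntisymm_cutoff {ε : ℝ} {n : ℕ} {f : Config n → ℂ} (hf : IsAntisymm f) :
    IsAntisymm fun c => if S.HasHighMode ε c then f c else 0 := by
  intro σ c
  have h : S.HasHighMode ε (fun i => c (σ i)) ↔ S.HasHighMode ε c :=
    σ.exists_congr_left.trans (by simp [HasHighMode])
  simp only [h, hf σ c]
  split_ifs <;> simp

open Classical in
theorem memℓp_cutoff {ι : Type*} (s : ι → Prop) {f : ι → ℂ} (hf : Memℓp f 2) :
    Memℓp (fun c => if s c then f c else 0) 2 := by
  apply memℓp_two_of_summable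
  have h := (memℓp_gen_iff (p := 2) (by norm_num)).1 hf
  refine Summable.of_nonneg_of_le (fun c => by positivity) (fun c => ?_)
    (h.congr fun c => by simp : Summable fun c => ‖f c‖ ^ 2)
  split_ifs <;> simp

open Classical in
/-- The projector `Π_ε^⊥`. The range of `Π_ε` is spanned by the products of plane waves all of
whose momenta lie in the Fermi ball or in the shell `μ < k² ≤ (1 + 1 / (ε log μ̃)) μ`; the range of
`Π_ε^⊥ = 1 - Π_ε` by those with at least one mode beyond the shell. -/
def PiPerp (ε : ℝ) {n : ℕ} : Fermi n →ₗ[ℂ] Fermi n where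
  toFun w := mkFermi (fun c => if S.HasHighMode ε c then coeff w c else 0)
    (memℓp_cutoff _ (coeff_memℓp w))
    (S.isAntisymm_cutoff (coeff_antisymm w))
  map_add' v w := by
    apply coeff_ext
    funext c
    change (if S.HasHighMode ε c then coeff v c + coeff w c else 0) =
      (if S.HasHighMode ε c then coeff v c else 0) + (if S.HasHighMode ε c then coeff w c else 0)
    split_ifs <;> simp
  map_smul' r w := by
    apply coeff_ext
    funext c
    change (if S.HasHighMode ε c then r * coeff w c else 0) =
      r * (if S.HasHighMode ε c then coeff w c else 0)
    split_ifs <;> simp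

open Classical in
theorem PiPerp_mem {ε : ℝ} {n : ℕ} {w : Fermi n} (hw : w ∈ finDom n) :
    S.PiPerp ε w ∈ finDom n := by
  refine Set.Finite.subset hw fun c hc => ?_
  intro h0
  apply hc
  change (if S.HasHighMode ε c then coeff w c else 0) = 0
  rw [h0]
  simp

/-- `Π_ε^⊥` on finite linear combinations of plane wave products. -/
def PiPerpFin (ε : ℝ) {n : ℕ} : finDom n →ₗ[ℂ] finDom n :=
  (S.PiPerp ε).restrict fun _ hw => S.PiPerp_mem hw

/-- The operator
`Ψ_p(λ, ε) = Π_ε^⊥ (G(p - P_f, T - λ) + P_p(λ) - K(ε, μ̃)) Π_ε^⊥` in `ℋₙ`, defined on finite linear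
combinations of plane wave products. -/
def Psi₀ (lam ε : ℝ) (p : Lattice) (n : ℕ) : Fermi n →ₗ.[ℂ] Fermi n where
  domain := finDom n
  toFun := S.PiPerp ε ∘ₗ
    ((finDom n).subtype ∘ₗ funPT S.L (fun P T => S.G (S.k p - P) (T - lam)) + S.P lam p n -
      ((S.K ε : ℝ) : ℂ) • (finDom n).subtype) ∘ₗ S.PiPerpFin ε

/-- `Ψ_p(λ, ε)` as an operator in `ℋ_{N(μ) - 1}`: the closure of the operator on finite linear
combinations of plane wave products, which form a domain of essential self-adjointness. -/
def Psi (lam ε : ℝ) (p : Lattice) : Fermi (S.N - 1) →ₗ.[ℂ] Fermi (S.N - 1) :=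
  (S.Psi₀ lam ε p (S.N - 1)).closure

end Model

/-- `A ≥ 0` for an unbounded operator: `⟨w, A w⟩` is real and nonnegative for `w` in the domain. -/
def OpNonneg {H : Type*} [NormedAddCommGroup H] [InnerProductSpace ℂ H] (A : H →ₗ.[ℂ] H) : Prop :=
  ∀ w : A.domain, 0 ≤ (⟪(w : H), A w⟫_ℂ).re ∧ (⟪(w : H), A w⟫_ℂ).im = 0

end FermiPolaron

end

open scoped InnerProductSpace

noncomputable section

namespace FermiPolaron

/-! ## Lattice sums -/

/-! The mechanism is that `G` grows like a fixed multiple of `log μ̃` on the range of `Π_ε^⊥`, while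
`P_p(λ)` is bounded below by quantities that are smaller once `ε` is small and `μ̃` is large.

Put `η = μ / (ε log μ̃)`. By the Pauli principle, `N(μ) - 1` fermions have kinetic energy at least
`E₀(μ) - μ` plus the excess of every momentum above the Fermi level (`Model.le_kinetic`). On the
range of `Π_ε^⊥` some momentum exceeds the level by more than `η`, and `λ ≤ E₀(μ)` because `e_P ≤
0`. Hence `T - λ ≥ -μ + η` there, and the energy gap `η` enters all estimates through `μ / η = ε log
μ̃`.

Lower bound on `G` (`Model.le_G`): for `k² ≤ 2μ` the first summand sums to a multiple of `log μ̃`,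
and the second costs at most `1/η` for each of `O(L² μ)` lattice points. For `k² > 2μ` averaging
over `k` and `-k` removes the slowly decaying linear term, which leaves `O(1)` uniformly in `q`.

Lower bound on `P_p(λ)` (`Model.neg_le_re_inner_P`): momenta are split at `k² = Dμ`, `D = 2M/(M -
1)`. If one of the two momenta is low, the resolvent is written as a Laplace integral of heat
kernels, and the Gaussian coupling between `k` and `l` as an average of plane waves. This factorises
the form into smeared operators `a(f)`, for which `‖a(f)‖ ≤ ‖f‖` independently of the particle
number (`sum_norm_annih_sq_le`). The outcome is `O(μ/η)` and `O(√(μ/η))`. If both are high, the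
product `k·l` is dropped from the denominator; what remains is `1/(f(k) + f(l))`, a positive kernel,
since `M > 1` makes `f` positive. The error decays fast enough to be controlled by the kinetic
energy (`neg_le_re_sum_high`), at cost `O(1)`.

All errors, including `K(ε, μ̃)`, are therefore `O(√ε log μ̃)` plus terms that are `o(log μ̃)` for
fixed `ε`, and nonnegativity passes to the closure. -/

theorem norm_mom_sq (L : ℝ) (z : Lattice) :
    ‖mom L z‖ ^ 2 = (2 * Real.pi / L * z 0) ^ 2 + (2 * Real.pi / L * z 1) ^ 2 := by
  rw [EuclideanSpace.real_norm_sq_eq, Fin.sum_univ_two]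
  rfl

/-- With `y = b (x + 1)`, the inequality `(s + y)² ≤ 2 (s² + y²)` bounds each term by `2 / ((s + b
x)(s + b (x + 1)))`, a telescoping difference. -/
theorem sum_range_inv_sq_le {s b : ℝ} (hs : 0 < s) (hb : 0 < b) (n : ℕ) :
    ∑ x ∈ Finset.range n, 1 / (s ^ 2 + (b * ((x : ℝ) + 1)) ^ 2) ≤ 2 / (b * s) := by
  have h : ∀ m : ℕ, ∑ x ∈ Finset.range m, 1 / (s ^ 2 + (b * ((x : ℝ) + 1)) ^ 2) ≤
      2 / b * (1 / s - 1 / (s + b * m)) := by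
    intro m
    induction m with
    | zero => simp
    | succ m ih =>
      rw [Finset.sum_range_succ]
      have hm : (0 : ℝ) ≤ m := Nat.cast_nonneg m
      have e : 2 / b * (1 / s - 1 / (s + b * ((m + 1 : ℕ) : ℝ))) =
          2 / b * (1 / s - 1 / (s + b * m)) + 2 / ((s + b * m) * (s + b * (m + 1))) := by
        push_cast
        field_simp
        ring
      rw [e]
      refine add_le_add ih ?_
      rw [div_le_div_iff₀ (by positivity) (by positivity)]
      nlinarith [sq_nonneg (s - b * (m + 1)), mul_nonneg hb.le hm, mul_pos hb hs]
  refine (h n).trans ?_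
  have h1 : 0 ≤ 1 / (s + b * n) := by positivity
  have h2 : 2 / (b * s) = 2 / b * (1 / s) := by field_simp
  rw [h2]
  exact mul_le_mul_of_nonneg_left (by linarith) (by positivity)

theorem sum_int_inv_sq_le {s b : ℝ} (hs : 0 < s) (hb : 0 < b) (hbs : b ≤ 2 * Real.pi * s)
    (F : Finset ℤ) : ∑ x ∈ F, 1 / (s ^ 2 + (b * (x : ℝ)) ^ 2) ≤ 11 / (b * s) := by
  obtain ⟨n, hn⟩ : ∃ n : ℕ, ∀ x ∈ F, x.natAbs ≤ n :=
    ⟨F.sup Int.natAbs, fun x hx => Finset.le_sup (f := Int.natAbs) hx⟩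
  set g : ℤ → ℝ := fun x => 1 / (s ^ 2 + (b * (x : ℝ)) ^ 2) with hg
  have hsub : F ⊆ {0} ∪ ((Finset.range n).image (fun x : ℕ => ((x : ℤ) + 1)) ∪
      (Finset.range n).image (fun x : ℕ => -((x : ℤ) + 1))) := by
    intro x hx
    have := hn x hx
    simp only [Finset.mem_union, Finset.mem_singleton, Finset.mem_image, Finset.mem_range]
    rcases lt_trichotomy x 0 with h | h | h
    · exact Or.inr (Or.inr ⟨x.natAbs - 1, by omega, by omega⟩)
    · exact Or.inl h
    · exact Or.inr (Or.inl ⟨x.natAbs - 1, by omega, by omega⟩)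
  have hg0 : ∀ x, 0 ≤ g x := fun x => by positivity
  have h1 : ∑ x ∈ (Finset.range n).image (fun x : ℕ => ((x : ℤ) + 1)), g x ≤ 2 / (b * s) := by
    rw [Finset.sum_image (fun x _ y _ h => by simpa using h)]
    refine le_of_eq_of_le (Finset.sum_congr rfl fun x _ => ?_) (sum_range_inv_sq_le hs hb n)
    simp [hg]
  have h2 : ∑ x ∈ (Finset.range n).image (fun x : ℕ => -((x : ℤ) + 1)), g x ≤ 2 / (b * s) := by
    rw [Finset.sum_image (fun x _ y _ h => by simpa using h)]
    refine le_of_eq_of_le (Finset.sum_congr rfl fun x _ => ?_) (sum_range_inv_sq_le hs hb n)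
    simp only [hg]
    push_cast
    ring
  -- The term at zero is `1/s²`, and `b ≤ 2π s < 7 s`. The two half-lines contribute 2 each, whence
  -- `11 = 7 + 2 + 2`.
  have h3 : g 0 ≤ 7 / (b * s) := by
    simp only [hg]
    rw [div_le_div_iff₀ (by positivity) (by positivity)]
    have := Real.pi_lt_d2
    push_cast
    nlinarith
  have hu : ∀ s t : Finset ℤ, ∑ x ∈ s ∪ t, g x ≤ ∑ x ∈ s, g x + ∑ x ∈ t, g x := by
    intro s t
    rw [← Finset.sum_union_inter]
    exact le_add_of_nonneg_right (Finset.sum_nonneg fun x _ => hg0 x)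
  have h4 := Finset.sum_le_sum_of_subset_of_nonneg hsub fun x _ _ => hg0 x
  have h5 := h4.trans ((hu _ _).trans (add_le_add_right (hu _ _) _))
  rw [Finset.sum_singleton] at h5
  have e : 11 / (b * s) = 7 / (b * s) + (2 / (b * s) + 2 / (b * s)) := by ring
  linarith

/-- Since `(s² + u² + v²)² ≥ (s² + u²)(s² + v²)`, the sum is at most a product of two
one-dimensional sums. The constant is 4 because `(11/(b s))² = 121 L²/(4π² A)` and `121 ≤ 16 π²`.
The condition `1 ≤ L² A` says that the lattice spacing does not exceed `2π √A`, so that the sum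
behaves like the integral. -/
theorem sum_inv_norm_mom_sq_le {L A : ℝ} (hL : 0 < L) (hA : 1 ≤ L ^ 2 * A) (F : Finset Lattice) :
    ∑ z ∈ F, 1 / (A + ‖mom L z‖ ^ 2) ^ 2 ≤ 4 * L ^ 2 / A := by
  have hpi := Real.pi_gt_three
  have hA0 : 0 < A := by
    by_contra h
    nlinarith [sq_nonneg L]
  set s := √A with hs
  have hs0 : 0 < s := Real.sqrt_pos.2 hA0
  have hsA : s ^ 2 = A := Real.sq_sqrt hA0.le
  set b := 2 * Real.pi / L with hb
  have hb0 : 0 < b := by positivity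
  have hbs : b ≤ 2 * Real.pi * s := by
    rw [hb, div_le_iff₀ hL]
    have : 1 ≤ s * L := by
      by_contra h
      have h' : s * L < 1 := not_le.1 h
      have : (s * L) ^ 2 < 1 := by
        have : 0 ≤ s * L := by positivity
        nlinarith
      nlinarith
    nlinarith
  set g : ℤ → ℝ := fun x => 1 / (s ^ 2 + (b * (x : ℝ)) ^ 2) with hg
  have hg0 : ∀ x, 0 ≤ g x := fun x => by positivity
  have hpt : ∀ z : Lattice, 1 / (A + ‖mom L z‖ ^ 2) ^ 2 ≤ g (z 0) * g (z 1) := by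
    intro z
    rw [norm_mom_sq, ← hsA, hg]
    simp only
    rw [one_div_mul_one_div]
    refine one_div_le_one_div_of_le (by positivity) ?_
    nlinarith [sq_nonneg s, sq_nonneg (b * z 0), sq_nonneg (b * z 1),
      mul_nonneg (sq_nonneg s) (sq_nonneg (b * z 0)), mul_nonneg (sq_nonneg s) (sq_nonneg (b * z 1)),
      mul_nonneg (sq_nonneg (b * z 0)) (sq_nonneg (b * z 1))]
  have hinj : Function.Injective fun z : Lattice => (z 0, z 1) := by
    intro z w h
    simp only [Prod.mk.injEq] at h
    funext i
    fin_cases i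
    · exact h.1
    · exact h.2
  calc ∑ z ∈ F, 1 / (A + ‖mom L z‖ ^ 2) ^ 2 ≤ ∑ z ∈ F, g (z 0) * g (z 1) :=
        Finset.sum_le_sum fun z _ => hpt z
    _ = ∑ q ∈ F.image fun z : Lattice => (z 0, z 1), g q.1 * g q.2 := by
        rw [Finset.sum_image hinj.injOn]
    _ ≤ ∑ q ∈ (F.image fun z => z 0) ×ˢ (F.image fun z => z 1), g q.1 * g q.2 := by
        refine Finset.sum_le_sum_of_subset_of_nonneg ?_ fun q _ _ => mul_nonneg (hg0 _) (hg0 _)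
        intro q hq
        simp only [Finset.mem_image, Finset.mem_product] at hq ⊢
        obtain ⟨z, hz, rfl⟩ := hq
        exact ⟨⟨z, hz, rfl⟩, ⟨z, hz, rfl⟩⟩
    _ = (∑ x ∈ F.image fun z => z 0, g x) * ∑ x ∈ F.image fun z => z 1, g x := by
        rw [Finset.sum_mul_sum, Finset.sum_product]
    _ ≤ (11 / (b * s)) * (11 / (b * s)) :=
        mul_le_mul (sum_int_inv_sq_le hs0 hb0 hbs _) (sum_int_inv_sq_le hs0 hb0 hbs _)
          (Finset.sum_nonneg fun x _ => hg0 x) (by positivity)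
    _ ≤ 4 * L ^ 2 / A := by
        rw [← hsA, hb, div_mul_div_comm, div_le_div_iff₀ (by positivity) (by positivity)]
        have e : 4 * L ^ 2 * (2 * Real.pi / L * s * (2 * Real.pi / L * s)) =
          16 * Real.pi ^ 2 * s ^ 2 := by
          field_simp
          ring
        rw [e]
        nlinarith [sq_nonneg s, mul_nonneg (sq_nonneg s) (sub_nonneg.2 hpi.le)]

/-- Each point counted contributes at least `1/((1 + D) m)²` to the preceding sum with `A = m`. -/
theorem card_mom_le {L D m : ℝ} (hL : 0 < L) (hm : 1 ≤ L ^ 2 * m) (hD : 0 ≤ D) (F : Finset Lattice)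
    (hF : ∀ z ∈ F, ‖mom L z‖ ^ 2 ≤ D * m) : (F.card : ℝ) ≤ 4 * (1 + D) ^ 2 * (L ^ 2 * m) := by
  have hm0 : 0 < m := by
    by_contra h
    nlinarith [sq_nonneg L]
  have h1 := sum_inv_norm_mom_sq_le hL hm F
  have h2 : ∑ _z ∈ F, 1 / ((1 + D) * m) ^ 2 ≤ ∑ z ∈ F, 1 / (m + ‖mom L z‖ ^ 2) ^ 2 := by
    refine Finset.sum_le_sum fun z hz => one_div_le_one_div_of_le (by positivity) ?_
    exact pow_le_pow_left₀ (by positivity) (by linarith [hF z hz]) 2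
  rw [Finset.sum_const, nsmul_eq_mul] at h2
  have h3 := h2.trans h1
  rw [mul_one_div, div_le_div_iff₀ (by positivity) hm0] at h3
  have : (F.card : ℝ) * m ≤ (4 * (1 + D) ^ 2 * (L ^ 2 * m)) * m := by nlinarith
  exact le_of_mul_le_mul_right this hm0

theorem log_le_sum_inv {m n : ℕ} (hm : 0 < m) (hmn : m ≤ n) :
    Real.log ((n : ℝ) / m) ≤ ∑ x ∈ Finset.Ico m n, 1 / (x : ℝ) := by
  induction n, hmn using Nat.le_induction with
  | base =>
    have : (m : ℝ) ≠ 0 := by positivity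
    simp [this]
  | succ n hn ih =>
    rw [Finset.sum_Ico_succ_top hn]
    have hm' : (0 : ℝ) < m := by exact_mod_cast hm
    have hn' : (0 : ℝ) < n := by exact_mod_cast hm.trans_le hn
    have e : (((n + 1 : ℕ) : ℝ)) / m = (n : ℝ) / m * (1 + 1 / n) := by
      push_cast
      field_simp
    rw [e, Real.log_mul (by positivity) (by positivity)]
    have := Real.log_le_sub_one_of_pos (x := 1 + 1 / (n : ℝ)) (by positivity)
    linarith

/-! ## Norm bound for smeared fermionic annihilation operators -/

section Bessel

variable {ι : Type*} {n : ℕ}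

theorem sum_eq_sum_insertNth [Fintype ι] {E : Type*} [AddCommMonoid E] (i : Fin (n + 1))
    (h : (Fin (n + 1) → ι) → E) :
    ∑ c, h c = ∑ d : Fin n → ι, ∑ x : ι, h (Fin.insertNth i x d) := by
  rw [← (Fin.insertNthEquiv (fun _ => ι) i).sum_comp, Fintype.sum_prod_type, Finset.sum_comm]
  rfl

theorem antisymm_insertNth {w : (Fin (n + 1) → ι) → ℂ}
    (hw : ∀ (σ : Equiv.Perm (Fin (n + 1))) c,
      w (fun i => c (σ i)) = ((Equiv.Perm.sign σ : ℤ) : ℂ) * w c)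
    (i : Fin (n + 1)) (x : ι) (d : Fin n → ι) :
    w (Fin.insertNth i x d) =
      ((Equiv.Perm.sign (Fin.cycleRange i) : ℤ) : ℂ) * w (Fin.cons x d) := by
  rw [← hw]
  congr 1
  exact (Fin.cons_comp_cycleRange x d i).symm

/-- Pauli principle: pairing two slots of an antisymmetric function with the same one-particle
function `f` gives a quantity equal to its own negative. It yields the orthogonality in the Bessel
argument below. -/
theorem sum_sum_update_eq_zero [Fintype ι] (f : ι → ℂ) {w : (Fin (n + 1) → ι) → ℂ}
    (hw : ∀ (σ : Equiv.Perm (Fin (n + 1))) c,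
      w (fun i => c (σ i)) = ((Equiv.Perm.sign σ : ℤ) : ℂ) * w c)
    {i j : Fin (n + 1)} (hij : i ≠ j) (c : Fin (n + 1) → ι) :
    ∑ x, f x * ∑ k, f k * w (Function.update (Function.update c i x) j k) = 0 := by
  have h : ∀ x k, w (Function.update (Function.update c i k) j x) =
      -w (Function.update (Function.update c i x) j k) := by
    intro x k
    have h1 := hw (Equiv.swap i j) (Function.update (Function.update c i x) j k)
    rw [Equiv.Perm.sign_swap hij] at h1
    simp only [Units.val_neg, Units.val_one, Int.cast_neg, Int.cast_one, neg_mul, one_mul] at h1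
    rw [← h1]
    congr 1
    funext m
    by_cases hm1 : m = i
    · subst hm1
      simp [hij]
    · by_cases hm2 : m = j
      · subst hm2
        simp [hij]
      · rw [Equiv.swap_apply_of_ne_of_ne hm1 hm2]
        simp [hm1, hm2]
  have h2 : ∑ x, f x * ∑ k, f k * w (Function.update (Function.update c i x) j k) =
      -∑ x, f x * ∑ k, f k * w (Function.update (Function.update c i x) j k) := by
    conv_lhs => simp only [Finset.mul_sum]
    rw [Finset.sum_comm]
    simp only [Finset.mul_sum]
    rw [← Finset.sum_neg_distrib]
    refine Finset.sum_congr rfl fun x _ => ?_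
    rw [← Finset.sum_neg_distrib]
    refine Finset.sum_congr rfl fun k _ => ?_
    rw [h x k]
    ring
  exact self_eq_neg.1 h2

/-- `‖a(f) w‖ ≤ ‖f‖ ‖w‖` for antisymmetric `w`. -/
theorem sum_norm_annih_sq_le [Fintype ι] (f : ι → ℂ) {w : (Fin (n + 1) → ι) → ℂ}
    (hw : ∀ (σ : Equiv.Perm (Fin (n + 1))) c,
      w (fun i => c (σ i)) = ((Equiv.Perm.sign σ : ℤ) : ℂ) * w c) :
    ((n : ℝ) + 1) * ∑ d : Fin n → ι, ‖∑ k, f k * w (Fin.snoc d k)‖ ^ 2 ≤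
      (∑ k, ‖f k‖ ^ 2) * ∑ c, ‖w c‖ ^ 2 := by
  set F : ℝ := ∑ k, ‖f k‖ ^ 2 with hF
  set T : Fin (n + 1) → (Fin n → ι) → ℂ := fun i d => ∑ k, f k * w (Fin.insertNth i k d) with hT
  set s : ℝ := ∑ d, ‖T 0 d‖ ^ 2 with hs
  have hTi : ∀ i d, ‖T i d‖ = ‖T 0 d‖ := by
    intro i d
    have e : T i d = ((Equiv.Perm.sign (Fin.cycleRange i) : ℤ) : ℂ) * T 0 d := by
      simp only [hT, Finset.mul_sum]
      refine Finset.sum_congr rfl fun k _ => ?_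
      rw [antisymm_insertNth hw, Fin.insertNth_zero']
      ring
    rw [e, norm_mul]
    rcases Int.units_eq_one_or (Equiv.Perm.sign (Fin.cycleRange i)) with h | h <;> simp [h]
  have hsi : ∀ i, ∑ d, ‖T i d‖ ^ 2 = s := fun i =>
    Finset.sum_congr rfl fun d _ => by rw [hTi]
  have hlast : ∑ d : Fin n → ι, ‖∑ k, f k * w (Fin.snoc d k)‖ ^ 2 = s := by
    rw [← hsi (Fin.last n)]
    simp only [hT, Fin.insertNth_last']
  rw [hlast]
  -- `g i` applies the rank-one operator `|f̄⟩⟨f̄|`, which is `F` times a projection, to slot `i` of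
  -- `w`. By antisymmetry all `g i` have the same norm and the same product with `W`, and distinct
  -- ones are orthogonal.
  set g : Fin (n + 1) → EuclideanSpace ℂ (Fin (n + 1) → ι) := fun i =>
    WithLp.toLp 2 fun c => star (f (c i)) * ∑ k, f k * w (Function.update c i k) with hg
  set W : EuclideanSpace ℂ (Fin (n + 1) → ι) := WithLp.toLp 2 w with hW
  have hgi : ∀ i x d, g i (Fin.insertNth i x d) = star (f x) * T i d := by
    intro i x d
    simp [hg, hT, Fin.update_insertNth]
  have hFs : ((F : ℝ) : ℂ) = ∑ k, f k * star (f k) := by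
    rw [hF]
    push_cast
    refine Finset.sum_congr rfl fun k _ => ?_
    exact (RCLike.mul_conj (f k)).symm
  have hgW : ∀ i, ⟪g i, W⟫_ℂ = s := by
    intro i
    rw [PiLp.inner_apply, sum_eq_sum_insertNth i, ← hsi i]
    push_cast
    refine Finset.sum_congr rfl fun d _ => ?_
    simp only [hgi]
    have e : ∀ x, ⟪star (f x) * T i d, W (Fin.insertNth i x d)⟫_ℂ =
        star (T i d) * (f x * w (Fin.insertNth i x d)) := by
      intro x
      simp only [RCLike.inner_apply, hW, map_mul, RCLike.star_def, RCLike.conj_conj]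
      ring
    simp only [e]
    rw [← Finset.mul_sum]
    exact RCLike.conj_mul (T i d)
  have hgg : ∀ i, ⟪g i, g i⟫_ℂ = ((F * s : ℝ) : ℂ) := by
    intro i
    rw [PiLp.inner_apply, sum_eq_sum_insertNth i, ← hsi i]
    push_cast
    rw [Finset.mul_sum, hFs]
    refine Finset.sum_congr rfl fun d _ => ?_
    simp only [hgi]
    rw [Finset.sum_mul]
    refine Finset.sum_congr rfl fun x _ => ?_
    have e2 : ((‖T i d‖ : ℝ) : ℂ) ^ 2 = star (T i d) * T i d := (RCLike.conj_mul (T i d)).symm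
    rw [e2]
    simp only [RCLike.inner_apply, map_mul, RCLike.star_def, RCLike.conj_conj]
    ring
  have hgj : ∀ i j, i ≠ j → ⟪g i, g j⟫_ℂ = 0 := by
    intro i j hij
    rw [PiLp.inner_apply, sum_eq_sum_insertNth i]
    refine Finset.sum_eq_zero fun d _ => ?_
    rcases isEmpty_or_nonempty ι with hι | ⟨⟨x₀⟩⟩
    · simp
    have e : ∀ x, ⟪g i (Fin.insertNth i x d), g j (Fin.insertNth i x d)⟫_ℂ =
        (star (T i d) * star (f (Fin.insertNth (α := fun _ => ι) i x₀ d j))) *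
        (f x * ∑ k, f k * w (Function.update (Function.update
          (Fin.insertNth (α := fun _ => ι) i x₀ d) i x) j k)) := by
      intro x
      have e1 : Fin.insertNth (α := fun _ => ι) i x d j =
          Fin.insertNth (α := fun _ => ι) i x₀ d j := by
        obtain ⟨m, rfl⟩ := Fin.exists_succAbove_eq hij.symm
        simp
      rw [hgi, Fin.update_insertNth]
      simp only [hg, e1, RCLike.inner_apply, map_mul, RCLike.star_def, RCLike.conj_conj]
      ring
    simp only [e]
    rw [← Finset.mul_sum, sum_sum_update_eq_zero f hw hij, mul_zero]
  have hWn : ‖W‖ ^ 2 = ∑ c, ‖w c‖ ^ 2 := by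
    rw [EuclideanSpace.norm_sq_eq]
  rw [← hWn]
  have hF0 : 0 ≤ F := Finset.sum_nonneg fun _ _ => by positivity
  have hs0 : 0 ≤ s := Finset.sum_nonneg fun _ _ => by positivity
  -- Bessel's inequality: expand `‖F W - ∑ᵢ gᵢ‖² ≥ 0`. Orthogonality leaves `n + 1` diagonal terms
  -- instead of `(n + 1)²`, which is why no particle number survives in the final bound.
  have key : 0 ≤ F * (F * ‖W‖ ^ 2 - (n + 1) * s) := by
    have h0 : 0 ≤ RCLike.re ⟪((F : ℝ) : ℂ) • W - ∑ i, g i, ((F : ℝ) : ℂ) • W - ∑ i, g i⟫_ℂ :=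
      inner_self_nonneg
    have hWg : ∀ i, ⟪W, g i⟫_ℂ = s := by
      intro i
      rw [← inner_conj_symm, hgW]
      simp
    have e : ⟪((F : ℝ) : ℂ) • W - ∑ i, g i, ((F : ℝ) : ℂ) • W - ∑ i, g i⟫_ℂ =
        ((F * (F * ‖W‖ ^ 2 - (n + 1) * s) : ℝ) : ℂ) := by
      have h3 : ⟪∑ i, g i, ∑ i, g i⟫_ℂ = (n + 1) * (F * s : ℝ) := by
        rw [sum_inner]
        have : ∀ i, ⟪g i, ∑ j, g j⟫_ℂ = ((F * s : ℝ) : ℂ) := by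
          intro i
          rw [inner_sum, Finset.sum_eq_single i, hgg]
          · intro j _ hj
            exact hgj i j hj.symm
          · simp
        simp [this]
      rw [inner_sub_left, inner_sub_right, inner_sub_right, inner_smul_left, inner_smul_left,
        inner_smul_right, inner_smul_right, h3, inner_sum, sum_inner, inner_self_eq_norm_sq_to_K]
      simp only [hWg, hgW]
      simp
      ring
    rw [e] at h0
    simpa only [RCLike.re_to_complex, Complex.ofReal_re] using h0
  rcases hF0.eq_or_lt with h | h
  · have hf : ∀ k, f k = 0 := by
      intro k
      have := (Finset.sum_eq_zero_iff_of_nonneg (fun k _ => by positivity)).1 h.symm k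
        (Finset.mem_univ k)
      simpa using this
    have : s = 0 := by simp [hs, hT, hf]
    rw [this, ← h]
    simp
  · have := nonneg_of_mul_nonneg_right key h
    linarith

end Bessel

/-! ## Bounds on `∑ a_l^* R a_k` by a Gaussian superposition -/

open MeasureTheory ProbabilityTheory

section Gaussian

variable {ι : Type*} [Fintype ι] {n : ℕ}

/-- Cauchy–Schwarz in the remaining particles `d`, followed by the fermionic bound for `f` and for
`g`. The factor `u` stands for the phase depending on the total momentum of `d`. -/
theorem norm_sum_conj_annih_mul_annih_le (f g : ι → ℂ) (u : (Fin n → ι) → ℂ)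
    (hu : ∀ d, ‖u d‖ ≤ 1) {w : (Fin (n + 1) → ι) → ℂ}
    (hw : ∀ (σ : Equiv.Perm (Fin (n + 1))) c,
      w (fun i => c (σ i)) = ((Equiv.Perm.sign σ : ℤ) : ℂ) * w c) :
    ((n : ℝ) + 1) * ‖∑ d : Fin n → ι, u d * (star (∑ l, g l * w (Fin.snoc d l)) *
        ∑ k, f k * w (Fin.snoc d k))‖ ≤
      √(∑ k, ‖f k‖ ^ 2) * √(∑ k, ‖g k‖ ^ 2) * ∑ c, ‖w c‖ ^ 2 := by
  set a : (Fin n → ι) → ℝ := fun d => ‖∑ l, g l * w (Fin.snoc d l)‖ with ha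
  set b : (Fin n → ι) → ℝ := fun d => ‖∑ l, f l * w (Fin.snoc d l)‖ with hb
  set W : ℝ := ∑ c, ‖w c‖ ^ 2 with hW
  have hW0 : 0 ≤ W := Finset.sum_nonneg fun _ _ => by positivity
  have h1 : ‖∑ d : Fin n → ι, u d * (star (∑ l, g l * w (Fin.snoc d l)) *
        ∑ k, f k * w (Fin.snoc d k))‖ ≤ ∑ d, a d * b d := by
    refine (norm_sum_le _ _).trans (Finset.sum_le_sum fun d _ => ?_)
    rw [norm_mul, norm_mul, norm_star]
    calc ‖u d‖ * (a d * b d) ≤ 1 * (a d * b d) :=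
          mul_le_mul_of_nonneg_right (hu d) (by positivity)
      _ = _ := one_mul _
  have h2 := Finset.sum_mul_sq_le_sq_mul_sq Finset.univ a b
  have h3 : ((n : ℝ) + 1) * ∑ d, a d ^ 2 ≤ _ := sum_norm_annih_sq_le g hw
  have h4 : ((n : ℝ) + 1) * ∑ d, b d ^ 2 ≤ _ := sum_norm_annih_sq_le f hw
  refine (mul_le_mul_of_nonneg_left h1 (by positivity)).trans ?_
  refine le_of_sq_le_sq ?_ (by positivity)
  rw [mul_pow, mul_pow, mul_pow, Real.sq_sqrt (Finset.sum_nonneg fun _ _ => by positivity),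
    Real.sq_sqrt (Finset.sum_nonneg fun _ _ => by positivity)]
  have ha0 : 0 ≤ ((n : ℝ) + 1) * ∑ d, a d ^ 2 :=
    mul_nonneg (by positivity) (Finset.sum_nonneg fun _ _ => by positivity)
  have hb0 : 0 ≤ ((n : ℝ) + 1) * ∑ d, b d ^ 2 :=
    mul_nonneg (by positivity) (Finset.sum_nonneg fun _ _ => by positivity)
  calc ((n : ℝ) + 1) ^ 2 * (∑ d, a d * b d) ^ 2
      ≤ ((n : ℝ) + 1) ^ 2 * ((∑ d, a d ^ 2) * ∑ d, b d ^ 2) :=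
        mul_le_mul_of_nonneg_left h2 (by positivity)
    _ = (((n : ℝ) + 1) * ∑ d, a d ^ 2) * (((n : ℝ) + 1) * ∑ d, b d ^ 2) := by ring
    _ ≤ _ := mul_le_mul h3 h4 hb0 (ha0.trans h3)
    _ = _ := by ring

theorem integrable_cexp_inner (v : Plane) :
    Integrable (fun y : Plane => Complex.exp (⟪y, v⟫_ℝ * Complex.I)) (stdGaussian Plane) := by
  refine Integrable.of_bound (C := 1) (by fun_prop) (Filter.Eventually.of_forall fun y => ?_)
  rw [Complex.norm_exp_ofReal_mul_I]

/-- The characteristic function of the standard Gaussian is `exp(-‖·‖²/2)`, evaluated at `√(2t/M)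
v`. This turns the heat factor of the impurity into an average of plane waves, whose phases split
over `q`, `k` and `l`. -/
theorem integral_cexp_inner {M t : ℝ} (hM : 0 < M) (ht : 0 ≤ t) (v : Plane) :
    ∫ y : Plane, Complex.exp (⟪y, √(2 * t / M) • v⟫_ℝ * Complex.I) ∂(stdGaussian Plane) =
      ((Real.exp (-t * (1 / M * ‖v‖ ^ 2)) : ℝ) : ℂ) := by
  rw [← charFun_apply, charFun_stdGaussian, Complex.ofReal_exp, ← Complex.ofReal_pow,
    norm_smul, mul_pow, Real.norm_eq_abs, sq_abs, Real.sq_sqrt (by positivity)]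
  congr 1
  push_cast
  field_simp

/-- The contribution of `k ∈ A`, `l ∈ B` to the heat kernel form at time `t`. -/
theorem norm_heat_form_le (x : ι → Plane) (kap : ι → ℝ) (A B : Finset ι) {M : ℝ} (hM : 0 < M)
    (q : (Fin n → ι) → Plane) (Y : (Fin n → ι) → ℝ) (X : (Fin (n + 1) → ι) → ℝ)
    (hX : ∀ (σ : Equiv.Perm (Fin (n + 1))) c, X (fun i => c (σ i)) = X c)
    (hXY : ∀ d k, X (Fin.snoc d k) = Y d + kap k)
    {w : (Fin (n + 1) → ι) → ℂ}
    (hw : ∀ (σ : Equiv.Perm (Fin (n + 1))) c,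
      w (fun i => c (σ i)) = ((Equiv.Perm.sign σ : ℤ) : ℂ) * w c)
    {η : ℝ} (hη : ∀ c, w c ≠ 0 → η ≤ X c) {t : ℝ} (ht : 0 ≤ t) :
    ((n : ℝ) + 1) * ‖∑ d : Fin n → ι, ∑ k ∈ A, ∑ l ∈ B,
        star (w (Fin.snoc d l)) * w (Fin.snoc d k) *
        ((Real.exp (-t * (Y d + kap k + kap l + 1 / M * ‖q d - x k - x l‖ ^ 2)) : ℝ) : ℂ)‖ ≤
      Real.exp (-t * η) * (√(∑ k ∈ A, Real.exp (-t * kap k)) *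
        √(∑ k ∈ B, Real.exp (-t * kap k))) * ∑ c, ‖w c‖ ^ 2 := by
  classical
  set s : ℝ := √(2 * t / M) with hs
  -- The exponent is shared out by `Y + kap k + kap l = (X(d,k) + X(d,l))/2 + (kap k + kap l)/2`.
  -- The halves with `X` are absorbed into `w`, which yields the decay `exp(-t η)`; the halves with
  -- `kap` go into the smearing functions `f` and `g`.
  set wt : (Fin (n + 1) → ι) → ℂ := fun c => ((Real.exp (-t * X c / 2) : ℝ) : ℂ) * w c with hwt
  have hwta : ∀ (σ : Equiv.Perm (Fin (n + 1))) c,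
      wt (fun i => c (σ i)) = ((Equiv.Perm.sign σ : ℤ) : ℂ) * wt c := by
    intro σ c
    simp only [hwt, hX, hw]
    ring
  have hWt : ∑ c, ‖wt c‖ ^ 2 ≤ Real.exp (-t * η) * ∑ c, ‖w c‖ ^ 2 := by
    rw [Finset.mul_sum]
    refine Finset.sum_le_sum fun c _ => ?_
    by_cases hc : w c = 0
    · simp [hwt, hc]
    · simp only [hwt]
      rw [norm_mul, mul_pow, Complex.norm_real, Real.norm_eq_abs, Real.abs_exp, ← Real.exp_nat_mul]
      refine mul_le_mul_of_nonneg_right (Real.exp_le_exp.2 ?_) (by positivity)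
      push_cast
      nlinarith [hη c hc]
  set f : Plane → ι → ℂ := fun y k => if k ∈ A then ((Real.exp (-t * kap k / 2) : ℝ) : ℂ) *
    Complex.exp ((⟪y, s • -x k⟫_ℝ : ℝ) * Complex.I) else 0 with hf
  set g : Plane → ι → ℂ := fun y k => if k ∈ B then ((Real.exp (-t * kap k / 2) : ℝ) : ℂ) *
    Complex.exp ((⟪y, s • x k⟫_ℝ : ℝ) * Complex.I) else 0 with hg
  set u : Plane → (Fin n → ι) → ℂ := fun y d =>
    Complex.exp ((⟪y, s • q d⟫_ℝ : ℝ) * Complex.I) with hu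
  have hnorm : ∀ r θ : ℝ, ‖((Real.exp (-t * r / 2) : ℝ) : ℂ) * Complex.exp ((θ : ℝ) * Complex.I)‖ ^ 2
      = Real.exp (-t * r) := by
    intro r θ
    rw [norm_mul, Complex.norm_exp_ofReal_mul_I, mul_one, Complex.norm_real, Real.norm_eq_abs,
      Real.abs_exp, ← Real.exp_nat_mul]
    congr 1
    push_cast
    ring
  have hfn : ∀ y, ∑ k, ‖f y k‖ ^ 2 = ∑ k ∈ A, Real.exp (-t * kap k) := by
    intro y
    rw [← Finset.sum_filter_add_sum_filter_not Finset.univ (· ∈ A)]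
    rw [Finset.filter_mem_eq_inter, Finset.univ_inter]
    rw [Finset.sum_congr rfl (fun k hk => by simp only [hf, if_pos hk]; exact hnorm _ _),
      Finset.sum_eq_zero (s := Finset.univ.filter fun k => k ∉ A), add_zero]
    intro k hk
    simp [hf, (Finset.mem_filter.1 hk).2]
  have hgn : ∀ y, ∑ k, ‖g y k‖ ^ 2 = ∑ k ∈ B, Real.exp (-t * kap k) := by
    intro y
    rw [← Finset.sum_filter_add_sum_filter_not Finset.univ (· ∈ B)]
    rw [Finset.filter_mem_eq_inter, Finset.univ_inter]
    rw [Finset.sum_congr rfl (fun k hk => by simp only [hg, if_pos hk]; exact hnorm _ _),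
      Finset.sum_eq_zero (s := Finset.univ.filter fun k => k ∉ B), add_zero]
    intro k hk
    simp [hg, (Finset.mem_filter.1 hk).2]
  have hpt : ∀ y, ∑ d : Fin n → ι, u y d * (star (∑ l, g y l * wt (Fin.snoc d l)) *
        ∑ k, f y k * wt (Fin.snoc d k)) =
      ∑ d : Fin n → ι, ∑ k ∈ A, ∑ l ∈ B, (star (w (Fin.snoc d l)) * w (Fin.snoc d k) *
        ((Real.exp (-t * (Y d + kap k + kap l)) : ℝ) : ℂ)) *
        Complex.exp ((⟪y, s • (q d - x k - x l)⟫_ℝ : ℝ) * Complex.I) := by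
    intro y
    refine Finset.sum_congr rfl fun d _ => ?_
    have e1 : ∑ k, f y k * wt (Fin.snoc d k) = ∑ k ∈ A, ((Real.exp (-t * kap k / 2) : ℝ) : ℂ) *
        Complex.exp ((⟪y, s • -x k⟫_ℝ : ℝ) * Complex.I) * wt (Fin.snoc d k) := by
      simp only [hf, ite_mul, zero_mul]
      rw [Finset.sum_ite_mem, Finset.univ_inter]
    have e2 : ∑ k, g y k * wt (Fin.snoc d k) = ∑ k ∈ B, ((Real.exp (-t * kap k / 2) : ℝ) : ℂ) *
        Complex.exp ((⟪y, s • x k⟫_ℝ : ℝ) * Complex.I) * wt (Fin.snoc d k) := by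
      simp only [hg, ite_mul, zero_mul]
      rw [Finset.sum_ite_mem, Finset.univ_inter]
    rw [e1, e2, mul_comm (star _), star_sum, Finset.sum_mul_sum, Finset.mul_sum]
    refine Finset.sum_congr rfl fun k _ => ?_
    rw [Finset.mul_sum]
    refine Finset.sum_congr rfl fun l _ => ?_
    have e3 : star (Complex.exp ((⟪y, s • x l⟫_ℝ : ℝ) * Complex.I)) =
        Complex.exp ((⟪y, s • -x l⟫_ℝ : ℝ) * Complex.I) := by
      rw [RCLike.star_def, ← Complex.exp_conj, map_mul, Complex.conj_I, Complex.conj_ofReal,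
        smul_neg, inner_neg_right]
      push_cast
      ring_nf
    have e4 : Complex.exp ((⟪y, s • (q d - x k - x l)⟫_ℝ : ℝ) * Complex.I) =
        Complex.exp ((⟪y, s • q d⟫_ℝ : ℝ) * Complex.I) *
        Complex.exp ((⟪y, s • -x k⟫_ℝ : ℝ) * Complex.I) *
        Complex.exp ((⟪y, s • -x l⟫_ℝ : ℝ) * Complex.I) := by
      rw [← Complex.exp_add, ← Complex.exp_add, ← add_mul, ← add_mul, ← Complex.ofReal_add,
        ← Complex.ofReal_add, ← inner_add_right, ← inner_add_right, ← smul_add, ← smul_add,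
        sub_eq_add_neg, sub_eq_add_neg]
    have e5 : Real.exp (-t * (Y d + kap k + kap l)) =
        Real.exp (-t * kap k / 2) * Real.exp (-t * X (Fin.snoc d k) / 2) *
        (Real.exp (-t * kap l / 2) * Real.exp (-t * X (Fin.snoc d l) / 2)) := by
      rw [← Real.exp_add, ← Real.exp_add, ← Real.exp_add, hXY, hXY]
      congr 1
      ring
    simp only [star_mul', e3, e4, e5, hwt, RCLike.star_def, Complex.conj_ofReal, hu]
    push_cast
    ring
  have hbound : ∀ y, ((n : ℝ) + 1) * ‖∑ d : Fin n → ι, ∑ k ∈ A, ∑ l ∈ B,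
        (star (w (Fin.snoc d l)) * w (Fin.snoc d k) *
        ((Real.exp (-t * (Y d + kap k + kap l)) : ℝ) : ℂ)) *
        Complex.exp ((⟪y, s • (q d - x k - x l)⟫_ℝ : ℝ) * Complex.I)‖ ≤
      Real.exp (-t * η) * (√(∑ k ∈ A, Real.exp (-t * kap k)) *
        √(∑ k ∈ B, Real.exp (-t * kap k))) * ∑ c, ‖w c‖ ^ 2 := by
    intro y
    rw [← hpt y]
    refine (norm_sum_conj_annih_mul_annih_le (f y) (g y) (u y) (fun d => ?_) hwta).trans ?_
    · simp only [hu]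
      rw [Complex.norm_exp_ofReal_mul_I]
    · rw [hfn, hgn]
      refine (mul_le_mul_of_nonneg_left hWt (by positivity)).trans (le_of_eq (by ring))
  have hint : ∑ d : Fin n → ι, ∑ k ∈ A, ∑ l ∈ B,
        star (w (Fin.snoc d l)) * w (Fin.snoc d k) *
        ((Real.exp (-t * (Y d + kap k + kap l + 1 / M * ‖q d - x k - x l‖ ^ 2)) : ℝ) : ℂ) =
      ∫ y : Plane, ∑ d : Fin n → ι, ∑ k ∈ A, ∑ l ∈ B,
        (star (w (Fin.snoc d l)) * w (Fin.snoc d k) *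
        ((Real.exp (-t * (Y d + kap k + kap l)) : ℝ) : ℂ)) *
        Complex.exp ((⟪y, s • (q d - x k - x l)⟫_ℝ : ℝ) * Complex.I) ∂(stdGaussian Plane) := by
    have hi : ∀ (z : ℂ) (v : Plane), Integrable
        (fun y : Plane => z * Complex.exp ((⟪y, v⟫_ℝ : ℝ) * Complex.I)) (stdGaussian Plane) :=
      fun z v => (integrable_cexp_inner v).const_mul z
    rw [integral_finsetSum _ fun d _ => integrable_finsetSum _ fun k _ =>
      integrable_finsetSum _ fun l _ => hi _ _]
    refine Finset.sum_congr rfl fun d _ => ?_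
    rw [integral_finsetSum _ fun k _ => integrable_finsetSum _ fun l _ => hi _ _]
    refine Finset.sum_congr rfl fun k _ => ?_
    rw [integral_finsetSum _ fun l _ => hi _ _]
    refine Finset.sum_congr rfl fun l _ => ?_
    rw [integral_const_mul, hs, integral_cexp_inner hM ht, mul_add, Real.exp_add]
    push_cast
    ring
  rw [hint]
  have hn : (0 : ℝ) < (n : ℝ) + 1 := by positivity
  rw [mul_comm, ← le_div_iff₀ hn]
  refine (norm_integral_le_of_norm_le_const (Filter.Eventually.of_forall fun y => ?_)).trans
    (le_of_eq (by rw [probReal_univ, mul_one]))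
  rw [le_div_iff₀ hn, mul_comm]
  exact hbound y

theorem integral_exp_neg_mul_Ioi {r : ℝ} (hr : 0 < r) :
    ∫ t in Set.Ioi (0 : ℝ), Real.exp (-t * r) = 1 / r := by
  have := integral_exp_mul_Ioi (a := -r) (by linarith) 0
  have e : (fun t : ℝ => Real.exp (-t * r)) = fun t => Real.exp (-r * t) := by
    funext t
    ring_nf
  rw [e, this]
  simp

theorem integrableOn_exp_neg_mul_Ioi {r : ℝ} (hr : 0 < r) :
    IntegrableOn (fun t : ℝ => Real.exp (-t * r)) (Set.Ioi 0) := by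
  have := integrableOn_exp_mul_Ioi (a := -r) (by linarith) 0
  refine this.congr_fun (fun t _ => ?_) measurableSet_Ioi
  simp only
  ring_nf

/-- Integrate the heat kernel bound over `t`. The denominator is `X(d,k) + kap l` plus a nonnegative
term, so it is at least `η` wherever `w(d,k) ≠ 0`; this is why a sign of `kap` is asked for on `B`
alone. -/
theorem norm_resolvent_form_le (x : ι → Plane) (kap : ι → ℝ) (A B : Finset ι) {M : ℝ} (hM : 0 < M)
    (q : (Fin n → ι) → Plane) (Y : (Fin n → ι) → ℝ) (X : (Fin (n + 1) → ι) → ℝ)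
    (hX : ∀ (σ : Equiv.Perm (Fin (n + 1))) c, X (fun i => c (σ i)) = X c)
    (hXY : ∀ d k, X (Fin.snoc d k) = Y d + kap k)
    {w : (Fin (n + 1) → ι) → ℂ}
    (hw : ∀ (σ : Equiv.Perm (Fin (n + 1))) c,
      w (fun i => c (σ i)) = ((Equiv.Perm.sign σ : ℤ) : ℂ) * w c)
    {η : ℝ} (hη0 : 0 < η) (hη : ∀ c, w c ≠ 0 → η ≤ X c) (hB : ∀ k ∈ B, 0 ≤ kap k) {b : ℝ → ℝ}
    (hb : IntegrableOn b (Set.Ioi 0))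
    (hAB : ∀ t, 0 < t → Real.exp (-t * η) * (√(∑ k ∈ A, Real.exp (-t * kap k)) *
        √(∑ k ∈ B, Real.exp (-t * kap k))) ≤ b t) :
    ((n : ℝ) + 1) * ‖∑ d : Fin n → ι, ∑ k ∈ A, ∑ l ∈ B,
        star (w (Fin.snoc d l)) * w (Fin.snoc d k) *
        ((1 / (Y d + kap k + kap l + 1 / M * ‖q d - x k - x l‖ ^ 2) : ℝ) : ℂ)‖ ≤
      (∫ t in Set.Ioi 0, b t) * ∑ c, ‖w c‖ ^ 2 := by
  set den : (Fin n → ι) → ι → ι → ℝ := fun d k l =>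
    Y d + kap k + kap l + 1 / M * ‖q d - x k - x l‖ ^ 2 with hden
  have hpos : ∀ d, ∀ k ∈ A, ∀ l ∈ B, star (w (Fin.snoc d l)) * w (Fin.snoc d k) ≠ 0 →
      0 < den d k l := by
    intro d k hk l hl h
    have h1 := hη _ (right_ne_zero_of_mul h)
    rw [hXY] at h1
    have h2 : 0 ≤ 1 / M * ‖q d - x k - x l‖ ^ 2 := by positivity
    have h3 := hB l hl
    simp only [hden]
    linarith
  have hi : ∀ d, ∀ k ∈ A, ∀ l ∈ B, IntegrableOn (fun t : ℝ => star (w (Fin.snoc d l)) *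
      w (Fin.snoc d k) * ((Real.exp (-t * den d k l) : ℝ) : ℂ)) (Set.Ioi 0) := by
    intro d k hk l hl
    by_cases h : star (w (Fin.snoc d l)) * w (Fin.snoc d k) = 0
    · simp only [h, zero_mul]
      exact integrableOn_zero
    · exact (integrableOn_exp_neg_mul_Ioi (hpos d k hk l hl h)).ofReal.const_mul _
  have hint : ∑ d : Fin n → ι, ∑ k ∈ A, ∑ l ∈ B, star (w (Fin.snoc d l)) * w (Fin.snoc d k) *
        ((1 / den d k l : ℝ) : ℂ) =
      ∫ t in Set.Ioi (0 : ℝ), ∑ d : Fin n → ι, ∑ k ∈ A, ∑ l ∈ B, star (w (Fin.snoc d l)) *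
      w (Fin.snoc d k) * ((Real.exp (-t * den d k l) : ℝ) : ℂ) := by
    rw [integral_finsetSum _ fun d _ => integrable_finsetSum _ fun k hk =>
      integrable_finsetSum _ fun l hl => hi d k hk l hl]
    refine Finset.sum_congr rfl fun d _ => ?_
    rw [integral_finsetSum _ fun k hk => integrable_finsetSum _ fun l hl => hi d k hk l hl]
    refine Finset.sum_congr rfl fun k hk => ?_
    rw [integral_finsetSum _ fun l hl => hi d k hk l hl]
    refine Finset.sum_congr rfl fun l hl => ?_
    by_cases h : star (w (Fin.snoc d l)) * w (Fin.snoc d k) = 0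
    · simp only [h, zero_mul, integral_zero]
    · rw [integral_const_mul, integral_complex_ofReal,
        integral_exp_neg_mul_Ioi (hpos d k hk l hl h)]
  have hn : (0 : ℝ) < (n : ℝ) + 1 := by positivity
  rw [hint, mul_comm, ← le_div_iff₀ hn, mul_div_assoc, ← integral_mul_const]
  refine norm_integral_le_of_norm_le (hb.mul_const _) ?_
  refine (ae_restrict_iff' measurableSet_Ioi).2 (Filter.Eventually.of_forall fun t ht => ?_)
  rw [← mul_div_assoc, le_div_iff₀ hn, mul_comm]
  refine (norm_heat_form_le x kap A B hM q Y X hX hXY hw hη (le_of_lt ht)).trans ?_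
  exact mul_le_mul_of_nonneg_right (hAB t ht) (Finset.sum_nonneg fun _ _ => by positivity)

end Gaussian

/-! ## Lower bound on `G` -/

theorem mom_neg (L : ℝ) (z : Lattice) : mom L (-z) = -mom L z := by
  ext i
  simp [mom]

namespace Model

variable (S : Model)

theorem tendsto_norm_cofinite :
    Filter.Tendsto (fun l : Lattice => ‖l‖) Filter.cofinite Filter.atTop := by
  rw [← Filter.cocompact_eq_cofinite]
  exact tendsto_norm_cocompact_atTop

theorem eventually_norm_k_sq_gt (r : ℝ) :
    ∀ᶠ z : Lattice in Filter.cofinite, r < ‖S.k z‖ ^ 2 := by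
  have hL := S.L_pos
  have hpi := Real.pi_pos
  filter_upwards [tendsto_norm_cofinite.eventually_gt_atTop (√|r| * (S.L / (2 * Real.pi)))]
    with z hz
  have h1 := hz.trans_le (S.sup_norm_le z)
  have h2 := lt_of_mul_lt_mul_right h1 (by positivity)
  calc r ≤ |r| := le_abs_self r
    _ = √|r| ^ 2 := (Real.sq_sqrt (abs_nonneg r)).symm
    _ < _ := pow_lt_pow_left₀ h2 (Real.sqrt_nonneg _) (by norm_num)

theorem finite_norm_k_sq_le (r : ℝ) : {z : Lattice | ‖S.k z‖ ^ 2 ≤ r}.Finite := by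
  have h := S.eventually_norm_k_sq_gt r
  rw [Filter.eventually_cofinite] at h
  simpa only [not_lt] using h

/-- The lattice points with `k² ≤ r`. -/
def ball (r : ℝ) : Finset Lattice := (S.finite_norm_k_sq_le r).toFinset

theorem mem_ball {r : ℝ} {z : Lattice} : z ∈ S.ball r ↔ ‖S.k z‖ ^ 2 ≤ r := by
  simp [ball]

/-- Only the points with labels `(x, y)`, `0 ≤ y < x`, `√|E_B| ≤ b x` and `b x < √μ` are kept. In
row `x` there are `x` of them, each contributing at least a multiple of `1/x²`, and the resulting
harmonic sum produces the logarithm. -/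
theorem le_sum_ball {a : ℝ} (ha : 0 < a) (hE : 1 ≤ S.L ^ 2 * |S.EB|) (hmu : |S.EB| ≤ S.mu) :
    S.L ^ 2 / (4 * Real.pi ^ 2 * (2 * a + 1)) * (Real.log S.muTilde / 2 - Real.log 8) ≤
      ∑ z ∈ S.ball (2 * S.mu), 1 / (a * ‖S.k z‖ ^ 2 - S.EB) := by
  have hL := S.L_pos
  have hpi := Real.pi_pos
  have hmu0 := S.mu_pos
  have hEB := S.EB_neg
  have hE0 : 0 < |S.EB| := abs_pos.2 hEB.ne
  have hEE : |S.EB| = -S.EB := abs_of_neg hEB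
  set E := |S.EB| with hEdef
  set b := 2 * Real.pi / S.L with hb
  have hb0 : 0 < b := by positivity
  set m := ⌈√E / b⌉₊ with hm
  set n := ⌈√S.mu / b⌉₊ with hn
  have hsE : 0 < √E := Real.sqrt_pos.2 hE0
  have hsm : 0 < √S.mu := Real.sqrt_pos.2 hmu0
  have hm0 : 0 < m := Nat.ceil_pos.2 (by positivity)
  have hmn : m ≤ n := Nat.ceil_mono (div_le_div_of_nonneg_right (Real.sqrt_le_sqrt hmu) hb0.le)
  have hlog := log_le_sum_inv hm0 hmn
  have hterm : ∀ x ∈ Finset.Ico m n, ∀ y ∈ Finset.range x,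
      ‖S.k ![(x : ℤ), (y : ℤ)]‖ ^ 2 ≤ 2 * b ^ 2 * (x : ℝ) ^ 2 := by
    intro x _ y hy
    have hy' : (y : ℝ) ≤ x := by exact_mod_cast (Finset.mem_range.1 hy).le
    have hy0 : (0 : ℝ) ≤ y := Nat.cast_nonneg y
    rw [Model.k, norm_mom_sq, ← hb]
    simp only [Matrix.cons_val_zero, Matrix.cons_val_one, Int.cast_natCast]
    have := pow_le_pow_left₀ hy0 hy' 2
    nlinarith [sq_nonneg b, mul_le_mul_of_nonneg_left this (sq_nonneg b)]
  have hsub : ∑ p ∈ (Finset.Ico m n).sigma fun x => Finset.range x,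
      1 / (a * ‖S.k ![(p.1 : ℤ), (p.2 : ℤ)]‖ ^ 2 - S.EB) ≤
      ∑ z ∈ S.ball (2 * S.mu), 1 / (a * ‖S.k z‖ ^ 2 - S.EB) := by
    have hinj : Set.InjOn (fun p : (_ : ℕ) × ℕ => (![(p.1 : ℤ), (p.2 : ℤ)] : Lattice))
        ((Finset.Ico m n).sigma fun x => Finset.range x) := by
      rintro ⟨x, y⟩ _ ⟨x', y'⟩ _ h
      have h0 := congrFun h 0
      have h1 := congrFun h 1
      simp only [Matrix.cons_val_zero, Matrix.cons_val_one, Nat.cast_inj] at h0 h1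
      subst h0 h1
      rfl
    rw [← Finset.sum_image (f := fun z : Lattice => 1 / (a * ‖S.k z‖ ^ 2 - S.EB)) hinj]
    refine Finset.sum_le_sum_of_subset_of_nonneg ?_ fun z _ _ => ?_
    · intro z hz
      obtain ⟨⟨x, y⟩, hp, rfl⟩ := Finset.mem_image.1 hz
      rw [Finset.mem_sigma] at hp
      rw [mem_ball]
      refine (hterm x hp.1 y hp.2).trans ?_
      have h1 : (x : ℝ) < √S.mu / b := Nat.lt_ceil.1 (Finset.mem_Ico.1 hp.1).2
      rw [lt_div_iff₀ hb0] at h1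
      have h2 := pow_le_pow_left₀ (by positivity) h1.le 2
      rw [Real.sq_sqrt hmu0.le] at h2
      nlinarith
    · have : 0 ≤ a * ‖S.k z‖ ^ 2 := by positivity
      exact div_nonneg zero_le_one (by linarith)
  refine le_trans ?_ hsub
  rw [Finset.sum_sigma]
  have hx : ∀ x ∈ Finset.Ico m n, 1 / ((2 * a + 1) * b ^ 2) * (1 / (x : ℝ)) ≤
      ∑ y ∈ Finset.range x, 1 / (a * ‖S.k ![(x : ℤ), (y : ℤ)]‖ ^ 2 - S.EB) := by
    intro x hx
    have hmx := (Finset.mem_Ico.1 hx).1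
    have hx0 : (0 : ℝ) < x := by exact_mod_cast hm0.trans_le hmx
    have h1 : √E / b ≤ x := (Nat.le_ceil _).trans (by exact_mod_cast hmx)
    rw [div_le_iff₀ hb0] at h1
    have h2 := pow_le_pow_left₀ hsE.le h1 2
    rw [Real.sq_sqrt hE0.le] at h2
    have h3 : ∀ y ∈ Finset.range x, 1 / ((2 * a + 1) * b ^ 2 * (x : ℝ) ^ 2) ≤
        1 / (a * ‖S.k ![(x : ℤ), (y : ℤ)]‖ ^ 2 - S.EB) := by
      intro y hy
      have h4 := mul_le_mul_of_nonneg_left (hterm x hx y hy) ha.le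
      refine one_div_le_one_div_of_le ?_ ?_
      · have : 0 ≤ a * ‖S.k ![(x : ℤ), (y : ℤ)]‖ ^ 2 := by positivity
        linarith
      · nlinarith
    refine le_trans (le_of_eq ?_) (Finset.sum_le_sum h3)
    rw [Finset.sum_const, Finset.card_range, nsmul_eq_mul]
    field_simp
  refine le_trans ?_ (Finset.sum_le_sum hx)
  rw [← Finset.mul_sum]
  have e1 : S.L ^ 2 / (4 * Real.pi ^ 2 * (2 * a + 1)) = 1 / ((2 * a + 1) * b ^ 2) := by
    rw [hb]
    field_simp
    ring
  rw [e1]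
  refine mul_le_mul_of_nonneg_left (le_trans ?_ hlog) (by positivity)
  have hsL : 1 ≤ √E * S.L := by
    by_contra h
    have h' : √E * S.L < 1 := not_le.1 h
    have h2 : (√E * S.L) ^ 2 < 1 := by
      have : 0 ≤ √E * S.L := by positivity
      nlinarith
    rw [mul_pow, Real.sq_sqrt hE0.le] at h2
    linarith
  -- Rounding up costs at most 1, and `1 ≤ L² |E_B|` gives `√E / b ≥ 1/(2π) ≥ 1/7`. This is the
  -- origin of `log 8`.
  have hmb : (m : ℝ) ≤ 8 * (√E / b) := by
    have h1 : (m : ℝ) < √E / b + 1 := Nat.ceil_lt_add_one (by positivity)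
    have h2 : 1 ≤ 7 * (√E / b) := by
      rw [hb, div_div_eq_mul_div, ← mul_div_assoc, le_div_iff₀ (by positivity)]
      have := Real.pi_lt_d2
      nlinarith
    linarith
  have hnb : √S.mu / b ≤ n := Nat.le_ceil _
  have hm0' : (0 : ℝ) < m := by exact_mod_cast hm0
  have e2 : Real.log S.muTilde / 2 - Real.log 8 = Real.log (√S.muTilde / 8) := by
    have : 0 < S.muTilde := by
      unfold muTilde
      positivity
    rw [Real.log_div (by positivity) (by norm_num), Real.log_sqrt this.le]
  rw [e2]
  have e3 : √S.muTilde = √S.mu / √E := Real.sqrt_div hmu0.le _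
  refine Real.log_le_log ?_ ?_
  · rw [e3]
    positivity
  · rw [e3, le_div_iff₀ hm0']
    calc √S.mu / √E / 8 * m ≤ √S.mu / √E / 8 * (8 * (√E / b)) :=
          mul_le_mul_of_nonneg_left hmb (by positivity)
      _ = √S.mu / b := by field_simp
      _ ≤ _ := hnb

open Classical in
/-- The summand of `G`. -/
def Gterm (q : Plane) (τ : ℝ) (z : Lattice) : ℝ :=
  1 / ((1 + 1 / S.M) * ‖S.k z‖ ^ 2 - S.EB) -
    if S.mu < ‖S.k z‖ ^ 2 then 1 / (1 / S.M * ‖q - S.k z‖ ^ 2 + ‖S.k z‖ ^ 2 + τ) else 0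

/-- Only half of `‖k‖²` is used: for `‖k‖² > 2μ` the other half compensates a shift `τ ≥ -μ`. -/
theorem kinetic_lower {M : ℝ} (hM : 0 < M) (q k : Plane) :
    1 / (8 + 2 * M) * (‖k‖ ^ 2 + ‖q‖ ^ 2) ≤ 1 / M * ‖q - k‖ ^ 2 + ‖k‖ ^ 2 / 2 := by
  have h1 : ‖q‖ ^ 2 ≤ 2 * ‖q - k‖ ^ 2 + 2 * ‖k‖ ^ 2 := by
    have h := norm_add_le (q - k) k
    rw [sub_add_cancel] at h
    have := pow_le_pow_left₀ (norm_nonneg _) h 2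
    nlinarith [sq_nonneg (‖q - k‖ - ‖k‖)]
  rw [one_div_mul_eq_div, div_le_iff₀ (by positivity)]
  have h2 : (1 / M * ‖q - k‖ ^ 2 + ‖k‖ ^ 2 / 2) * (8 + 2 * M) =
    2 * ‖q - k‖ ^ 2 + 8 / M * ‖q - k‖ ^ 2 + (4 + M) * ‖k‖ ^ 2 := by
    field_simp
    ring
  rw [h2]
  have h3 : 0 ≤ 8 / M * ‖q - k‖ ^ 2 := by positivity
  have h4 : 0 ≤ M * ‖k‖ ^ 2 := by positivity
  nlinarith [sq_nonneg ‖k‖]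

/-- On a common denominator the quadratic terms cancel, leaving a numerator linear in `‖k‖` over a
quartic one; the decay `‖z‖⁻³` is summable in two dimensions. -/
theorem summable_Gterm (q : Plane) (τ : ℝ) (hτ : -S.mu ≤ τ) : Summable (S.Gterm q τ) := by
  have hL := S.L_pos
  have hpi := Real.pi_pos
  have hmu0 := S.mu_pos
  have hM := S.M_pos
  have hEB := S.EB_neg
  set r : ℝ := S.L / (2 * Real.pi) with hr
  have hr0 : 0 < r := by positivity
  set C₁ : ℝ := |‖q‖ ^ 2 / S.M + τ + S.EB| with hC₁
  set c : ℝ := 1 / (8 + 2 * S.M) with hc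
  have hc0 : 0 < c := by positivity
  have hs : Summable fun z : Lattice =>
      ((C₁ + 2 / S.M * ‖q‖) / c * r ^ 3) * ‖z‖ ^ (-3 : ℝ) :=
    (EisensteinSeries.summable_one_div_norm_rpow (k := 3) (by norm_num)).mul_left _
  refine Summable.of_norm_bounded_eventually hs ?_
  filter_upwards [S.eventually_norm_k_sq_gt (2 * S.mu), S.eventually_norm_k_sq_gt 1,
    tendsto_norm_cofinite.eventually_gt_atTop 0] with z hz hz1 hz0
  set K := ‖S.k z‖ with hK
  have hK1 : 1 < K := by
    by_contra h
    have hK0 : 0 ≤ K := norm_nonneg _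
    nlinarith
  have hmu : S.mu < K ^ 2 := by linarith
  have hd1 : K ^ 2 ≤ (1 + 1 / S.M) * K ^ 2 - S.EB := by
    have : 0 ≤ 1 / S.M * K ^ 2 := by positivity
    linarith
  have hd2 : c * K ^ 2 ≤ 1 / S.M * ‖q - S.k z‖ ^ 2 + K ^ 2 + τ := by
    have h1 := kinetic_lower hM q (S.k z)
    have h2 : 0 ≤ c * ‖q‖ ^ 2 := by positivity
    rw [← hc, ← hK] at h1
    linarith
  have hK0 : 0 < K ^ 2 := by positivity
  have hcK : 0 < c * K ^ 2 := by positivity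
  have hid : ‖q - S.k z‖ ^ 2 = ‖q‖ ^ 2 - 2 * ⟪q, S.k z⟫_ℝ + K ^ 2 := norm_sub_sq_real _ _
  have hCS : |⟪q, S.k z⟫_ℝ| ≤ ‖q‖ * K := abs_real_inner_le_norm _ _
  have hzK : ‖z‖ ≤ K * r := S.sup_norm_le z
  rw [Gterm, ← hK, if_pos hmu, div_sub_div _ _ (hK0.trans_le hd1).ne' (hcK.trans_le hd2).ne',
    norm_div, Real.norm_of_nonneg (mul_nonneg (hK0.le.trans hd1) (hcK.le.trans hd2))]
  have hnum : ‖1 * (1 / S.M * ‖q - S.k z‖ ^ 2 + K ^ 2 + τ) -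
      ((1 + 1 / S.M) * K ^ 2 - S.EB) * 1‖ ≤ (C₁ + 2 / S.M * ‖q‖) * K := by
    have e : 1 * (1 / S.M * ‖q - S.k z‖ ^ 2 + K ^ 2 + τ) -
      ((1 + 1 / S.M) * K ^ 2 - S.EB) * 1 =
      (‖q‖ ^ 2 / S.M + τ + S.EB) - 2 / S.M * ⟪q, S.k z⟫_ℝ := by
      rw [hid]
      ring
    rw [e]
    refine (norm_sub_le _ _).trans ?_
    rw [norm_mul, Real.norm_of_nonneg (by positivity : (0 : ℝ) ≤ 2 / S.M), Real.norm_eq_abs,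
      Real.norm_eq_abs, ← hC₁]
    have h1 : C₁ ≤ C₁ * K := le_mul_of_one_le_right (abs_nonneg _) hK1.le
    have h2 := mul_le_mul_of_nonneg_left hCS (by positivity : (0 : ℝ) ≤ 2 / S.M)
    linarith
  have hC0 : 0 ≤ C₁ + 2 / S.M * ‖q‖ := by positivity
  calc _ ≤ (C₁ + 2 / S.M * ‖q‖) * K / (K ^ 2 * (c * K ^ 2)) :=
        div_le_div₀ (by positivity) hnum (by positivity)
          (mul_le_mul hd1 hd2 hcK.le (hK0.le.trans hd1))
    _ = (C₁ + 2 / S.M * ‖q‖) / c * (1 / K ^ 3) := by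
        field_simp
    _ ≤ (C₁ + 2 / S.M * ‖q‖) / c * (r ^ 3 / ‖z‖ ^ 3) := by
        refine mul_le_mul_of_nonneg_left ?_ (by positivity)
        rw [div_le_div_iff₀ (by positivity) (by positivity), one_mul, ← mul_pow, mul_comm r]
        exact pow_le_pow_left₀ (norm_nonneg _) hzK 3
    _ = _ := by
        rw [Real.rpow_neg (norm_nonneg _), show (3 : ℝ) = ((3 : ℕ) : ℝ) by norm_num,
          Real.rpow_natCast]
        ring

/-- The denominators at `k` and `-k` are `B - x` and `B + x` with `x = (2/M) q·k`, and the mean of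
their inverses is `1/B + x²/(B (B² - x²))`. The first part is compared with the free term, using
only `τ + E_B ≥ -2μ`. The second is of order `Q K/(K + Q)³`, whose lattice sum is bounded uniformly
in `q`. -/
theorem le_Gterm_symm (q : Plane) (τ : ℝ) (hτ : -S.mu ≤ τ) (hmu : |S.EB| ≤ S.mu) (z : Lattice)
    (hz : 2 * S.mu < ‖S.k z‖ ^ 2) :
    -(16 * S.mu * (1 / (S.mu + ‖S.k z‖ ^ 2) ^ 2) + 16 * (8 + 2 * S.M) ^ 3 / S.M ^ 2 *
      ((‖q‖ ^ 2 + S.mu) * (1 / ((‖q‖ ^ 2 + S.mu) + ‖S.k z‖ ^ 2) ^ 2))) ≤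
      1 / 2 * (S.Gterm q τ z + S.Gterm q τ (-z)) := by
  have hmu0 := S.mu_pos
  have hM := S.M_pos
  have hEB := S.EB_neg
  rw [abs_of_neg hEB] at hmu
  have hneg : S.k (-z) = -S.k z := mom_neg _ _
  set c : ℝ := 1 / (8 + 2 * S.M) with hc
  have hc0 : 0 < c := by positivity
  set K : ℝ := ‖S.k z‖ ^ 2 with hK
  set Q : ℝ := ‖q‖ ^ 2 with hQ
  have hQ0 : 0 ≤ Q := by positivity
  have hK0 : 0 < K := by linarith
  set x : ℝ := 2 / S.M * ⟪q, S.k z⟫_ℝ with hx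
  set B : ℝ := (1 + 1 / S.M) * K + Q / S.M + τ with hB
  have e1 : 1 / S.M * ‖q - S.k z‖ ^ 2 + K + τ = B - x := by
    rw [norm_sub_sq_real, hB, hx]
    ring
  have e2 : 1 / S.M * ‖q - -S.k z‖ ^ 2 + K + τ = B + x := by
    rw [sub_neg_eq_add, norm_add_sq_real, hB, hx]
    ring
  have l1 : c * (K + Q) ≤ B - x := by
    have := kinetic_lower hM q (S.k z)
    rw [← hc, ← hK] at this
    rw [← e1]
    linarith
  have l2 : c * (K + Q) ≤ B + x := by
    have := kinetic_lower hM q (-S.k z)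
    rw [← hc, norm_neg, ← hK] at this
    rw [← e2]
    linarith
  have l0 : 0 < c * (K + Q) := by positivity
  have lB : c * (K + Q) ≤ B := by linarith
  have hx2 : x ^ 2 ≤ 4 / S.M ^ 2 * (Q * K) := by
    have h1 : ⟪q, S.k z⟫_ℝ ^ 2 ≤ Q * K := by
      rw [hQ, hK, ← mul_pow, ← sq_abs]
      exact pow_le_pow_left₀ (abs_nonneg _) (abs_real_inner_le_norm _ _) 2
    have e : x ^ 2 = 4 / S.M ^ 2 * ⟪q, S.k z⟫_ℝ ^ 2 := by
      rw [hx]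
      ring
    rw [e]
    exact mul_le_mul_of_nonneg_left h1 (by positivity)
  have hlt : S.mu < K := by linarith
  have hlt' : S.mu < ‖S.k (-z)‖ ^ 2 := by
    rw [hneg, norm_neg]
    exact hlt
  have e3 : 1 / 2 * (S.Gterm q τ z + S.Gterm q τ (-z)) =
      (1 / ((1 + 1 / S.M) * K - S.EB) - 1 / B) - x ^ 2 / (B * ((B - x) * (B + x))) := by
    rw [Gterm, Gterm, if_pos hlt, if_pos hlt', hneg, norm_neg, ← hK, e1, e2]
    have n1 : B - x ≠ 0 := (l0.trans_le l1).ne'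
    have n2 : B + x ≠ 0 := (l0.trans_le l2).ne'
    have n3 : B ≠ 0 := (l0.trans_le lB).ne'
    generalize 1 / ((1 + 1 / S.M) * K - S.EB) = y
    field_simp
    ring
  rw [e3]
  have b1 : -(16 * S.mu * (1 / (S.mu + K) ^ 2)) ≤ 1 / ((1 + 1 / S.M) * K - S.EB) - 1 / B := by
    have hMK : 0 ≤ 1 / S.M * K := by positivity
    have hQM : 0 ≤ Q / S.M := by positivity
    have h1 : K ≤ (1 + 1 / S.M) * K - S.EB := by linarith
    have h2 : K / 2 ≤ B := by
      rw [hB]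
      linarith
    have hBp := l0.trans_le lB
    rw [div_sub_div _ _ (hK0.trans_le h1).ne' hBp.ne', neg_le_iff_add_nonneg,
      mul_one_div, ← sub_neg_eq_add, sub_nonneg, ← neg_div,
      div_le_div_iff₀ (by positivity) (mul_pos (hK0.trans_le h1) hBp)]
    have hd : K * (K / 2) ≤ ((1 + 1 / S.M) * K - S.EB) * B :=
      mul_le_mul h1 h2 (by positivity) (hK0.le.trans h1)
    have hn : -(2 * S.mu) ≤ 1 * B - ((1 + 1 / S.M) * K - S.EB) * 1 := by
      rw [hB]
      linarith
    have h3 : (S.mu + K) ^ 2 ≤ 4 * K ^ 2 :=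
      (pow_le_pow_left₀ (by positivity) (by linarith : S.mu + K ≤ 2 * K) 2).trans
        (le_of_eq (by ring))
    have h4 : -(2 * S.mu) * (S.mu + K) ^ 2 ≤
        (1 * B - ((1 + 1 / S.M) * K - S.EB) * 1) * (S.mu + K) ^ 2 :=
      mul_le_mul_of_nonneg_right hn (by positivity)
    have h5 := mul_le_mul_of_nonneg_left h3 (by positivity : 0 ≤ 2 * S.mu)
    have h6 := mul_le_mul_of_nonneg_left hd (by positivity : 0 ≤ 16 * S.mu)
    linarith
  have b2 : x ^ 2 / (B * ((B - x) * (B + x))) ≤ 16 * (8 + 2 * S.M) ^ 3 / S.M ^ 2 *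
      ((Q + S.mu) * (1 / ((Q + S.mu) + K) ^ 2)) := by
    have h1 : (c * (K + Q)) * ((c * (K + Q)) * (c * (K + Q))) ≤ B * ((B - x) * (B + x)) :=
      mul_le_mul lB (mul_le_mul l1 l2 l0.le (l0.le.trans l1)) (by positivity) (l0.le.trans lB)
    calc x ^ 2 / (B * ((B - x) * (B + x)))
        ≤ (4 / S.M ^ 2 * (Q * K)) / ((c * (K + Q)) * ((c * (K + Q)) * (c * (K + Q)))) :=
          div_le_div₀ (by positivity) hx2 (by positivity) h1
      _ = 4 * (8 + 2 * S.M) ^ 3 / S.M ^ 2 * (Q * K / (K + Q) ^ 3) := by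
          rw [hc]
          field_simp
      _ ≤ 4 * (8 + 2 * S.M) ^ 3 / S.M ^ 2 *
          (4 * ((Q + S.mu) * (1 / ((Q + S.mu) + K) ^ 2))) := by
          refine mul_le_mul_of_nonneg_left ?_ (by positivity)
          rw [mul_one_div, ← mul_div_assoc, div_le_div_iff₀ (by positivity) (by positivity)]
          have h2 : ((Q + S.mu) + K) ^ 2 ≤ 4 * (K + Q) ^ 2 :=
            (pow_le_pow_left₀ (by positivity) (by linarith : (Q + S.mu) + K ≤ 2 * (K + Q)) 2).trans
              (le_of_eq (by ring))
          have h3 : Q * K ≤ (Q + S.mu) * (K + Q) :=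
            mul_le_mul (by linarith) (by linarith) hK0.le (by positivity)
          calc Q * K * ((Q + S.mu) + K) ^ 2 ≤ ((Q + S.mu) * (K + Q)) * (4 * (K + Q) ^ 2) :=
                mul_le_mul h3 h2 (by positivity) (by positivity)
            _ = _ := by ring
      _ = _ := by ring
  linarith

/-- `G(q, τ)` is bounded below by a positive multiple of `log μ̃`, up to an error of order
`1 + μ / η`, if `τ ≥ -μ + η`. -/
theorem le_G (hE : 1 ≤ S.L ^ 2 * |S.EB|) (hmu : |S.EB| ≤ S.mu) (q : Plane) {τ η : ℝ} (hη : 0 < η)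
    (hτ : -S.mu + η ≤ τ) :
    1 / (4 * Real.pi ^ 2 * (2 * (1 + 1 / S.M) + 1)) * (Real.log S.muTilde / 2 - Real.log 8) -
      36 * (S.mu / η) - (64 + 64 * (8 + 2 * S.M) ^ 3 / S.M ^ 2) ≤ S.G q τ := by
  have hL := S.L_pos
  have hmu0 := S.mu_pos
  have hM := S.M_pos
  have hEB := S.EB_neg
  have hτ' : -S.mu ≤ τ := by linarith
  have hLmu : 1 ≤ S.L ^ 2 * S.mu := hE.trans (mul_le_mul_of_nonneg_left hmu (by positivity))
  have hs := S.summable_Gterm q τ hτ'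
  have hs' : Summable fun z => S.Gterm q τ (-z) := (Equiv.neg Lattice).summable_iff.2 hs
  have ht : ∑' z, S.Gterm q τ (-z) = ∑' z, S.Gterm q τ z := (Equiv.neg Lattice).tsum_eq _
  set g : Lattice → ℝ := fun z => 1 / 2 * (S.Gterm q τ z + S.Gterm q τ (-z)) with hg
  have hgs : HasSum g (∑' z, S.Gterm q τ z) := by
    have := (hs.hasSum.add hs'.hasSum).mul_left (1 / 2)
    rwa [ht, ← two_mul, ← mul_assoc, show (1 / 2 : ℝ) * 2 = 1 by norm_num, one_mul] at this
  have hG : S.G q τ = 1 / S.L ^ 2 * ∑' z, S.Gterm q τ z := rfl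
  set C₂ : ℝ := 16 * (8 + 2 * S.M) ^ 3 / S.M ^ 2 with hC₂
  have hC₂0 : 0 ≤ C₂ := by positivity
  set a : ℝ := 1 + 1 / S.M with ha
  have ha0 : 0 < a := by positivity
  set F₀ := S.ball (2 * S.mu) with hF₀
  -- Inside the ball each subtracted term has `k² > μ`, so its denominator exceeds `η`. The number
  -- of points is at most `4 (1 + 2)² L² μ = 36 L² μ`.
  have hlow : ∑ z ∈ F₀, 1 / (a * ‖S.k z‖ ^ 2 - S.EB) - 36 * (S.L ^ 2 * S.mu) / η ≤
      ∑ z ∈ F₀, g z := by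
    have h1 : ∀ z, 1 / (a * ‖S.k z‖ ^ 2 - S.EB) - 1 / η ≤ S.Gterm q τ z := by
      intro z
      rw [Gterm, ← ha]
      refine sub_le_sub_left ?_ _
      split_ifs with h
      · refine one_div_le_one_div_of_le hη ?_
        have : 0 ≤ 1 / S.M * ‖q - S.k z‖ ^ 2 := by positivity
        linarith
      · positivity
    have h2 : ∀ z ∈ F₀, 1 / (a * ‖S.k z‖ ^ 2 - S.EB) - 1 / η ≤ g z := by
      intro z _
      have h3 := h1 z
      have h4 := h1 (-z)
      have hneg : S.k (-z) = -S.k z := mom_neg _ _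
      rw [hneg, norm_neg] at h4
      simp only [hg]
      linarith
    refine le_trans ?_ (Finset.sum_le_sum h2)
    rw [Finset.sum_sub_distrib, Finset.sum_const, nsmul_eq_mul, mul_one_div]
    have hcard := card_mom_le hL hLmu (D := 2) (by norm_num) F₀ fun z hz => S.mem_ball.1 hz
    refine sub_le_sub_left (div_le_div_of_nonneg_right ?_ hη.le) _
    linarith
  have hmain := S.le_sum_ball ha0 hE hmu
  have hbound : ∀ F : Finset Lattice, F₀ ⊆ F →
      S.L ^ 2 / (4 * Real.pi ^ 2 * (2 * a + 1)) * (Real.log S.muTilde / 2 - Real.log 8) -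
      36 * (S.L ^ 2 * S.mu) / η - (64 + 4 * C₂) * S.L ^ 2 ≤ ∑ z ∈ F, g z := by
    intro F hF
    rw [← Finset.sum_sdiff hF]
    have h1 : ∀ z ∈ F \ F₀, -(16 * S.mu * (1 / (S.mu + ‖S.k z‖ ^ 2) ^ 2) + C₂ *
        ((‖q‖ ^ 2 + S.mu) * (1 / ((‖q‖ ^ 2 + S.mu) + ‖S.k z‖ ^ 2) ^ 2))) ≤ g z := by
      intro z hz
      refine S.le_Gterm_symm q τ hτ' hmu z ?_
      have := (Finset.mem_sdiff.1 hz).2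
      rw [hF₀, mem_ball, not_le] at this
      exact this
    have h2 := Finset.sum_le_sum h1
    rw [Finset.sum_neg_distrib, Finset.sum_add_distrib, ← Finset.mul_sum, ← Finset.mul_sum,
      ← Finset.mul_sum] at h2
    have h3 := mul_le_mul_of_nonneg_left (sum_inv_norm_mom_sq_le hL hLmu (F \ F₀)) hmu0.le
    have hQ : 0 ≤ ‖q‖ ^ 2 := by positivity
    have h4 := mul_le_mul_of_nonneg_left (sum_inv_norm_mom_sq_le hL (A := ‖q‖ ^ 2 + S.mu)
      (hLmu.trans (mul_le_mul_of_nonneg_left (by linarith) (by positivity))) (F \ F₀))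
      (by positivity : 0 ≤ ‖q‖ ^ 2 + S.mu)
    rw [mul_div_cancel₀ _ (by positivity)] at h3 h4
    have h5 := mul_le_mul_of_nonneg_left h4 hC₂0
    linarith
  have hlim := ge_of_tendsto hgs ((Filter.eventually_ge_atTop F₀).mono fun F hF => hbound F hF)
  rw [hG]
  have h6 := mul_le_mul_of_nonneg_left hlim (by positivity : 0 ≤ 1 / S.L ^ 2)
  refine le_trans (le_of_eq ?_) h6
  rw [hC₂]
  field_simp
  ring

end Model

/-! ## The contribution of high momenta -/

section High

variable {ι : Type*}

/-- `1/(f(k) + f(l)) = ∫ exp(-t f(k)) exp(-t f(l)) dt`, so the form is an integral of squares. -/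
theorem re_sum_inv_add_nonneg (H : Finset ι) (f : ι → ℝ) (hf : ∀ k ∈ H, 0 < f k) (V : ι → ℂ) :
    0 ≤ (∑ k ∈ H, ∑ l ∈ H, star (V l) * V k * ((1 / (f k + f l) : ℝ) : ℂ)).re := by
  have hi : ∀ k ∈ H, ∀ l ∈ H, IntegrableOn (fun t : ℝ => star (V l) * V k *
      ((Real.exp (-t * (f k + f l)) : ℝ) : ℂ)) (Set.Ioi 0) := by
    intro k hk l hl
    exact (integrableOn_exp_neg_mul_Ioi (add_pos (hf k hk) (hf l hl))).ofReal.const_mul _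
  have hint : ∑ k ∈ H, ∑ l ∈ H, star (V l) * V k * ((1 / (f k + f l) : ℝ) : ℂ) =
      ∫ t in Set.Ioi (0 : ℝ), ∑ k ∈ H, ∑ l ∈ H, star (V l) * V k *
        ((Real.exp (-t * (f k + f l)) : ℝ) : ℂ) := by
    rw [integral_finsetSum _ fun k hk => integrable_finsetSum _ fun l hl => hi k hk l hl]
    refine Finset.sum_congr rfl fun k hk => ?_
    rw [integral_finsetSum _ fun l hl => hi k hk l hl]
    refine Finset.sum_congr rfl fun l hl => ?_
    rw [integral_const_mul, integral_complex_ofReal,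
      integral_exp_neg_mul_Ioi (add_pos (hf k hk) (hf l hl))]
  have hsq : ∀ t : ℝ, ∑ k ∈ H, ∑ l ∈ H, star (V l) * V k *
        ((Real.exp (-t * (f k + f l)) : ℝ) : ℂ) =
      ((‖∑ k ∈ H, ((Real.exp (-t * f k) : ℝ) : ℂ) * V k‖ ^ 2 : ℝ) : ℂ) := by
    intro t
    have e : ((‖∑ k ∈ H, ((Real.exp (-t * f k) : ℝ) : ℂ) * V k‖ ^ 2 : ℝ) : ℂ) =
        (∑ k ∈ H, ((Real.exp (-t * f k) : ℝ) : ℂ) * V k) *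
        star (∑ k ∈ H, ((Real.exp (-t * f k) : ℝ) : ℂ) * V k) := by
      push_cast
      exact (RCLike.mul_conj _).symm
    rw [e, star_sum, Finset.sum_mul_sum]
    refine Finset.sum_congr rfl fun k _ => Finset.sum_congr rfl fun l _ => ?_
    rw [mul_add, Real.exp_add, star_mul', RCLike.star_def, Complex.conj_ofReal]
    push_cast
    ring
  rw [hint]
  simp only [hsq]
  rw [integral_complex_ofReal, Complex.ofReal_re]
  exact integral_nonneg fun t => by positivity

/-- The identity `|q - k - l|² = |q - k|² + |q - l|² - |q|² + 2 k·l` shows that, without the product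
`k·l`, the denominator is `f(k) + f(l)` and the kernel is positive. Restoring the product changes
the kernel by at most a multiple of `|k||l|/(Y + k² + l²)²`. -/
theorem neg_le_re_sum_resolvent {M : ℝ} (hM : 1 < M) {m : ℝ} (hm : 0 < m) (x : ι → Plane)
    (H : Finset ι) (hH : ∀ k ∈ H, 2 * M / (M - 1) * m ≤ ‖x k‖ ^ 2) (V : ι → ℂ) {Y : ℝ}
    (hY : 0 ≤ Y) (q : Plane) :
    -(8 * M / (M - 1) ^ 2 * ∑ k ∈ H, ‖x k‖ ^ 2 * ‖V k‖ ^ 2 *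
        ∑ l ∈ H, 1 / (Y + ‖x k‖ ^ 2 + ‖x l‖ ^ 2) ^ 2) ≤
      (∑ k ∈ H, ∑ l ∈ H, star (V l) * V k * ((1 / (Y + (‖x k‖ ^ 2 - m) + (‖x l‖ ^ 2 - m) +
        1 / M * ‖q - x k - x l‖ ^ 2) : ℝ) : ℂ)).re := by
  have hM0 : 0 < M := by linarith
  have hM1 : 0 < M - 1 := by linarith
  set θ : ℝ := (M - 1) / (2 * M) with hθ
  have hθ0 : 0 < θ := by positivity
  have hθ1 : θ ≤ 1 / 2 := by
    rw [hθ, div_le_div_iff₀ (by positivity) (by norm_num)]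
    linarith
  have hmk : ∀ k ∈ H, m ≤ θ * ‖x k‖ ^ 2 := by
    intro k hk
    have h1 := mul_le_mul_of_nonneg_left (hH k hk) hθ0.le
    have e : θ * (2 * M / (M - 1) * m) = m := by
      rw [hθ]
      field_simp
    linarith
  set f : ι → ℝ := fun k => Y / 2 + (‖x k‖ ^ 2 - m) + 1 / M * ‖q - x k‖ ^ 2 -
    1 / (2 * M) * ‖q‖ ^ 2 with hf
  have hfl : ∀ k ∈ H, Y / 2 + θ * ‖x k‖ ^ 2 ≤ f k := by
    intro k hk
    have h1 := hmk k hk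
    -- Completing the square in `q` shows that the impurity part of `f` is at least `-‖x k‖²/M`.
    -- Since `M > 1`, a fraction `1 - 1/M = 2θ` of `‖x k‖²` remains, and the cutoff on `H` makes `m`
    -- cost at most half of it.
    have h2 : 1 / M * ‖q - x k‖ ^ 2 - 1 / (2 * M) * ‖q‖ ^ 2 + 1 / M * ‖x k‖ ^ 2 =
        1 / (2 * M) * ‖q - (2 : ℝ) • x k‖ ^ 2 := by
      rw [norm_sub_sq_real, norm_sub_sq_real, norm_smul, inner_smul_right]
      norm_num
      field_simp
      ring
    have h3 : 0 ≤ 1 / (2 * M) * ‖q - (2 : ℝ) • x k‖ ^ 2 := by positivity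
    have h4 : 1 / M = 1 - 2 * θ := by
      rw [hθ]
      field_simp
      ring
    have h5 : 1 / M * ‖x k‖ ^ 2 = ‖x k‖ ^ 2 - 2 * (θ * ‖x k‖ ^ 2) := by
      rw [h4]
      ring
    simp only [hf]
    linarith
  have hx0 : ∀ k ∈ H, 0 < ‖x k‖ ^ 2 := by
    intro k hk
    by_contra h
    have h1 := hmk k hk
    nlinarith
  have hfp : ∀ k ∈ H, 0 < f k := fun k hk =>
    lt_of_lt_of_le (add_pos_of_nonneg_of_pos (by positivity) (mul_pos hθ0 (hx0 k hk))) (hfl k hk)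
  set R : ι → ι → ℝ := fun k l => 1 / (Y + (‖x k‖ ^ 2 - m) + (‖x l‖ ^ 2 - m) +
        1 / M * ‖q - x k - x l‖ ^ 2) with hR
  have hcmp : ∀ k ∈ H, ∀ l ∈ H, |R k l - 1 / (f k + f l)| ≤
      8 * M / (M - 1) ^ 2 * (‖x k‖ * ‖x l‖ * (1 / (Y + ‖x k‖ ^ 2 + ‖x l‖ ^ 2) ^ 2)) := by
    intro k hk l hl
    set Z : ℝ := Y + ‖x k‖ ^ 2 + ‖x l‖ ^ 2 with hZ
    have hZ0 : 0 < Z := by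
      have := hx0 k hk
      have := hx0 l hl
      positivity
    have h1 : θ * Z ≤ f k + f l := by
      have := hfl k hk
      have := hfl l hl
      have : θ * Y ≤ 1 * Y := mul_le_mul_of_nonneg_right (by linarith) hY
      rw [hZ, mul_add, mul_add]
      linarith
    have h2 : θ * Z ≤ Y + (‖x k‖ ^ 2 - m) + (‖x l‖ ^ 2 - m) + 1 / M * ‖q - x k - x l‖ ^ 2 := by
      have := hmk k hk
      have := hmk l hl
      have : 2 * θ * Z ≤ 1 * Z := mul_le_mul_of_nonneg_right (by linarith) hZ0.le
      have : 0 ≤ 1 / M * ‖q - x k - x l‖ ^ 2 := by positivity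
      have : θ * Z = θ * Y + θ * ‖x k‖ ^ 2 + θ * ‖x l‖ ^ 2 := by rw [hZ]; ring
      have : 0 ≤ θ * Y := by positivity
      linarith
    have hθZ : 0 < θ * Z := by positivity
    have e : f k + f l - (Y + (‖x k‖ ^ 2 - m) + (‖x l‖ ^ 2 - m) + 1 / M * ‖q - x k - x l‖ ^ 2) =
        -(2 / M * ⟪x k, x l⟫_ℝ) := by
      simp only [hf]
      rw [norm_sub_sq_real (q - x k), norm_sub_sq_real q, norm_sub_sq_real q, inner_sub_left]
      field_simp
      ring
    simp only [hR]
    rw [div_sub_div _ _ (hθZ.trans_le h2).ne' (hθZ.trans_le h1).ne', one_mul, mul_one, e, abs_div,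
      abs_neg, abs_mul, abs_of_nonneg (by positivity : (0 : ℝ) ≤ 2 / M),
      abs_of_nonneg (mul_nonneg (hθZ.le.trans h2) (hθZ.le.trans h1))]
    calc _ ≤ 2 / M * (‖x k‖ * ‖x l‖) / ((θ * Z) * (θ * Z)) :=
          div_le_div₀ (by positivity)
            (mul_le_mul_of_nonneg_left (abs_real_inner_le_norm _ _) (by positivity))
            (by positivity) (mul_le_mul h2 h1 hθZ.le (hθZ.le.trans h2))
      _ = _ := by
          rw [hθ]
          field_simp
          ring
  set C : ℝ := 8 * M / (M - 1) ^ 2 with hC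
  have hC0 : 0 ≤ C := by positivity
  have hsplit : ∑ k ∈ H, ∑ l ∈ H, star (V l) * V k * ((R k l : ℝ) : ℂ) =
      ∑ k ∈ H, ∑ l ∈ H, star (V l) * V k * ((1 / (f k + f l) : ℝ) : ℂ) +
      ∑ k ∈ H, ∑ l ∈ H, star (V l) * V k * ((R k l - 1 / (f k + f l) : ℝ) : ℂ) := by
    rw [← Finset.sum_add_distrib]
    refine Finset.sum_congr rfl fun k _ => ?_
    rw [← Finset.sum_add_distrib]
    refine Finset.sum_congr rfl fun l _ => ?_
    push_cast
    ring
  have hrem : ‖∑ k ∈ H, ∑ l ∈ H, star (V l) * V k * ((R k l - 1 / (f k + f l) : ℝ) : ℂ)‖ ≤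
      C * ∑ k ∈ H, ‖x k‖ ^ 2 * ‖V k‖ ^ 2 * ∑ l ∈ H, 1 / (Y + ‖x k‖ ^ 2 + ‖x l‖ ^ 2) ^ 2 := by
    -- `2ab ≤ a² + b²` with `a = ‖x k‖ ‖V k‖` and `b = ‖x l‖ ‖V l‖`. The two halves agree after
    -- exchanging `k` and `l`.
    have h1 : ∀ k ∈ H, ∀ l ∈ H, ‖star (V l) * V k * ((R k l - 1 / (f k + f l) : ℝ) : ℂ)‖ ≤
        C / 2 * (‖x k‖ ^ 2 * ‖V k‖ ^ 2 * (1 / (Y + ‖x k‖ ^ 2 + ‖x l‖ ^ 2) ^ 2)) +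
        C / 2 * (‖x l‖ ^ 2 * ‖V l‖ ^ 2 * (1 / (Y + ‖x l‖ ^ 2 + ‖x k‖ ^ 2) ^ 2)) := by
      intro k hk l hl
      rw [norm_mul, norm_mul, norm_star, Complex.norm_real, Real.norm_eq_abs]
      refine (mul_le_mul_of_nonneg_left (hcmp k hk l hl) (by positivity)).trans ?_
      rw [add_right_comm Y (‖x l‖ ^ 2)]
      set z : ℝ := 1 / (Y + ‖x k‖ ^ 2 + ‖x l‖ ^ 2) ^ 2 with hz
      have hz0 : 0 ≤ z := by positivity
      have h2 : 0 ≤ C / 2 * z * (‖x k‖ * ‖V k‖ - ‖x l‖ * ‖V l‖) ^ 2 := by positivity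
      linarith
    refine (norm_sum_le _ _).trans ((Finset.sum_le_sum fun k hk => (norm_sum_le _ _).trans
      (Finset.sum_le_sum fun l hl => h1 k hk l hl)).trans (le_of_eq ?_))
    simp only [Finset.sum_add_distrib]
    rw [Finset.sum_comm (f := fun k l => C / 2 * (‖x l‖ ^ 2 * ‖V l‖ ^ 2 *
      (1 / (Y + ‖x l‖ ^ 2 + ‖x k‖ ^ 2) ^ 2)))]
    simp only [← Finset.mul_sum]
    ring
  rw [hsplit, Complex.add_re]
  have h1 := re_sum_inv_add_nonneg H f hfp V
  have h2 := (abs_le.1 ((Complex.abs_re_le_norm _).trans hrem)).1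
  linarith

variable [Fintype ι] {n : ℕ}

/-- `∑_k b(k) a_k^* a_k` acts as multiplication by `∑ᵢ b(kᵢ)`. -/
theorem sum_number_eq (a : (Fin (n + 1) → ι) → ℝ)
    (ha : ∀ (σ : Equiv.Perm (Fin (n + 1))) c, a (fun i => c (σ i)) = a c) (b : ι → ℝ) :
    ((n : ℝ) + 1) * ∑ d : Fin n → ι, ∑ k, b k * a (Fin.snoc d k) = ∑ c, (∑ i, b (c i)) * a c := by
  have h1 : ∀ i : Fin (n + 1), ∑ c, b (c i) * a c =
      ∑ d : Fin n → ι, ∑ k, b k * a (Fin.cons k d) := by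
    intro i
    rw [sum_eq_sum_insertNth i]
    refine Finset.sum_congr rfl fun d _ => Finset.sum_congr rfl fun k _ => ?_
    rw [Fin.insertNth_apply_same, ← ha (Fin.cycleRange i) (Fin.cons k d)]
    congr 2
    exact (Fin.cons_comp_cycleRange k d i).symm
  have h2 : ∑ d : Fin n → ι, ∑ k, b k * a (Fin.snoc d k) =
      ∑ d : Fin n → ι, ∑ k, b k * a (Fin.cons k d) := by
    rw [← h1 (Fin.last n), sum_eq_sum_insertNth (Fin.last n)]
    refine Finset.sum_congr rfl fun d _ => Finset.sum_congr rfl fun k _ => ?_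
    rw [Fin.insertNth_apply_same, Fin.insertNth_last']
  simp only [Finset.sum_mul]
  have h3 : ∑ c, ∑ i, b (c i) * a c = ∑ i, ∑ c, b (c i) * a c := Finset.sum_comm
  rw [h2, h3]
  simp only [h1]
  simp

/-- In the error term the sum over `l` is at most `4L²/(Y + k²)`, and `Y + k²` equals `X + m` for
the full configuration. The remaining sum over `k` is then the expectation of `∑ᵢ b(kᵢ)/(X + m)`,
that is, of the kinetic energy of the high momenta divided by the total excess energy, which is at
most 2. -/
theorem neg_le_re_sum_high {M L m : ℝ} (hM : 1 < M) (hL : 0 < L) (hm : 1 ≤ L ^ 2 * m)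
    (z : ι → Lattice) (hz : Function.Injective z) (H : Finset ι)
    (hH : ∀ k ∈ H, 2 * M / (M - 1) * m ≤ ‖mom L (z k)‖ ^ 2)
    (q : (Fin n → ι) → Plane) (Y : (Fin n → ι) → ℝ) (X : (Fin (n + 1) → ι) → ℝ)
    (hX : ∀ (σ : Equiv.Perm (Fin (n + 1))) c, X (fun i => c (σ i)) = X c)
    (hXY : ∀ d k, X (Fin.snoc d k) = Y d + (‖mom L (z k)‖ ^ 2 - m))
    {w : (Fin (n + 1) → ι) → ℂ}
    (hw : ∀ (σ : Equiv.Perm (Fin (n + 1))) c,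
      w (fun i => c (σ i)) = ((Equiv.Perm.sign σ : ℤ) : ℂ) * w c)
    (hY : ∀ d k, w (Fin.snoc d k) ≠ 0 → 0 ≤ Y d)
    (hXs : ∀ c, w c ≠ 0 → ∑ i, Set.indicator (H : Set ι) (fun k => ‖mom L (z k)‖ ^ 2 - m) (c i)
      ≤ X c) :
    -(64 * M / (M - 1) ^ 2 * L ^ 2 * ∑ c, ‖w c‖ ^ 2) ≤
      ((n : ℝ) + 1) * (∑ d : Fin n → ι, ∑ k ∈ H, ∑ l ∈ H,
        star (w (Fin.snoc d l)) * w (Fin.snoc d k) *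
        ((1 / (Y d + (‖mom L (z k)‖ ^ 2 - m) + (‖mom L (z l)‖ ^ 2 - m) +
          1 / M * ‖q d - mom L (z k) - mom L (z l)‖ ^ 2) : ℝ) : ℂ)).re := by
  classical
  have hm0 : 0 < m := by
    by_contra h
    nlinarith [sq_nonneg L]
  have hM0 : 0 < M := by linarith
  have hM1 : 0 < M - 1 := by linarith
  have hm2 : ∀ k ∈ H, 2 * m ≤ ‖mom L (z k)‖ ^ 2 := by
    intro k hk
    refine le_trans (mul_le_mul_of_nonneg_right ?_ hm0.le) (hH k hk)
    rw [le_div_iff₀ hM1]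
    linarith
  set C : ℝ := 8 * M / (M - 1) ^ 2 with hC
  have hC0 : 0 ≤ C := by positivity
  set b : ι → ℝ := fun k => if k ∈ H then ‖mom L (z k)‖ ^ 2 else 0 with hb
  set a : (Fin (n + 1) → ι) → ℝ := fun c => ‖w c‖ ^ 2 / (X c + m) with ha
  have haσ : ∀ (σ : Equiv.Perm (Fin (n + 1))) c, a (fun i => c (σ i)) = a c := by
    intro σ c
    simp only [ha, hX, hw, norm_mul]
    rcases Int.units_eq_one_or (Equiv.Perm.sign σ) with h | h <;> simp [h]
  have hd : ∀ d : Fin n → ι, -(C * (4 * L ^ 2) * ∑ k, b k * a (Fin.snoc d k)) ≤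
      (∑ k ∈ H, ∑ l ∈ H, star (w (Fin.snoc d l)) * w (Fin.snoc d k) *
        ((1 / (Y d + (‖mom L (z k)‖ ^ 2 - m) + (‖mom L (z l)‖ ^ 2 - m) +
          1 / M * ‖q d - mom L (z k) - mom L (z l)‖ ^ 2) : ℝ) : ℂ)).re := by
    intro d
    by_cases h0 : ∀ k, w (Fin.snoc d k) = 0
    · simp [h0, ha]
    push Not at h0
    obtain ⟨k₀, hk₀⟩ := h0
    have hYd := hY d k₀ hk₀
    refine le_trans (neg_le_neg ?_) (neg_le_re_sum_resolvent hM hm0 (fun k => mom L (z k)) H hH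
      (fun k => w (Fin.snoc d k)) hYd (q d))
    rw [mul_assoc]
    refine mul_le_mul_of_nonneg_left ?_ hC0
    simp only [hb, ite_mul, zero_mul]
    rw [Finset.sum_ite_mem, Finset.univ_inter, Finset.mul_sum]
    refine Finset.sum_le_sum fun k hk => ?_
    have hk2 := hm2 k hk
    have hA : m ≤ Y d + ‖mom L (z k)‖ ^ 2 := by linarith
    have h1 : ∑ l ∈ H, 1 / (Y d + ‖mom L (z k)‖ ^ 2 + ‖mom L (z l)‖ ^ 2) ^ 2 ≤
        4 * L ^ 2 / (Y d + ‖mom L (z k)‖ ^ 2) := by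
      rw [← Finset.sum_image (s := H) (g := z) (f := fun y : Lattice =>
        1 / (Y d + ‖mom L (z k)‖ ^ 2 + ‖mom L y‖ ^ 2) ^ 2) hz.injOn]
      exact sum_inv_norm_mom_sq_le hL
        (hm.trans (mul_le_mul_of_nonneg_left hA (by positivity))) _
    refine (mul_le_mul_of_nonneg_left h1 (by positivity)).trans (le_of_eq ?_)
    simp only [ha, hXY]
    rw [show Y d + (‖mom L (z k)‖ ^ 2 - m) + m = Y d + ‖mom L (z k)‖ ^ 2 by ring]
    ring
  have hnum := sum_number_eq a haσ b
  have hle : ∑ c, (∑ i, b (c i)) * a c ≤ 2 * ∑ c, ‖w c‖ ^ 2 := by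
    rw [Finset.mul_sum]
    refine Finset.sum_le_sum fun c _ => ?_
    by_cases hc : w c = 0
    · simp [ha, hc]
    have h1 := hXs c hc
    have h2 : ∑ i, b (c i) ≤
        2 * ∑ i, Set.indicator (H : Set ι) (fun k => ‖mom L (z k)‖ ^ 2 - m) (c i) := by
      rw [Finset.mul_sum]
      refine Finset.sum_le_sum fun i _ => ?_
      by_cases hi : c i ∈ H
      · rw [Set.indicator_of_mem (by exact_mod_cast hi)]
        simp only [hb, if_pos hi]
        linarith [hm2 _ hi]
      · rw [Set.indicator_of_notMem (by exact_mod_cast hi)]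
        simp [hb, hi]
    have h3 : 0 ≤ ∑ i, Set.indicator (H : Set ι) (fun k => ‖mom L (z k)‖ ^ 2 - m) (c i) := by
      refine Finset.sum_nonneg fun i _ => Set.indicator_nonneg (fun k hk => ?_) _
      linarith [hm2 k (by exact_mod_cast hk)]
    have h4 : 0 < X c + m := by linarith
    simp only [ha]
    rw [← mul_div_assoc, div_le_iff₀ h4, mul_right_comm]
    exact mul_le_mul_of_nonneg_right (by linarith) (by positivity)
  rw [Complex.re_sum]
  have h5 := mul_le_mul_of_nonneg_left (Finset.sum_le_sum fun d (_ : d ∈ Finset.univ) => hd d)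
    (by positivity : 0 ≤ (n : ℝ) + 1)
  refine le_trans ?_ h5
  rw [Finset.sum_neg_distrib, ← Finset.mul_sum, mul_neg, neg_le_neg_iff, mul_left_comm, hnum]
  refine (mul_le_mul_of_nonneg_left hle (by positivity)).trans (le_of_eq ?_)
  rw [hC]
  ring

end High

/-! ## Quadratic forms in terms of Fourier coefficients -/

theorem eq_zero_of_not_injective {n : ℕ} {f : Config n → ℂ} (hf : IsAntisymm f) {c : Config n}
    (hc : ¬ Function.Injective c) : f c = 0 := by
  simp only [Function.Injective, not_forall] at hc
  obtain ⟨i, j, hij, hne⟩ := hc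
  have h := hf (Equiv.swap i j) c
  rw [Equiv.Perm.sign_swap hne] at h
  have e : (fun m => c (Equiv.swap i j m)) = c := by
    funext m
    by_cases h1 : m = i
    · rw [h1, Equiv.swap_apply_left, hij]
    · by_cases h2 : m = j
      · rw [h2, Equiv.swap_apply_right, hij]
      · rw [Equiv.swap_apply_of_ne_of_ne h1 h2]
  rw [e] at h
  simp only [Units.val_neg, Units.val_one, Int.cast_neg, Int.cast_one, neg_mul, one_mul] at h
  exact self_eq_neg.1 h

/-- Confines a finite linear combination to finitely many momenta, so that the estimates over a
`Fintype` of labels apply. -/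
theorem exists_finset_momenta {n : ℕ} {v : Fermi n} (hv : v ∈ finDom n) :
    ∃ K : Finset Lattice, ∀ c, coeff v c ≠ 0 → ∀ i, c i ∈ K := by
  classical
  have hv' : (Function.support (coeff v)).Finite := hv
  refine ⟨hv'.toFinset.biUnion fun c => Finset.univ.image c, fun c hc i => ?_⟩
  rw [Finset.mem_biUnion]
  exact ⟨c, hv'.mem_toFinset.2 hc, Finset.mem_image_of_mem _ (Finset.mem_univ i)⟩

theorem tsum_config_eq {n : ℕ} {E : Type*} [AddCommMonoid E] [TopologicalSpace E] [T2Space E]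
    {K : Finset Lattice} {F : Config n → E} (hF : ∀ c, F c ≠ 0 → ∀ i, c i ∈ K) :
    ∑' c, F c = ∑ c : Fin n → K, F fun i => (c i : Lattice) := by
  have hinj : Function.Injective fun (c : Fin n → K) (i : Fin n) => (c i : Lattice) := by
    intro c d h
    funext i
    exact Subtype.ext (congrFun h i)
  rw [← tsum_fintype (L := SummationFilter.unconditional _), hinj.tsum_eq]
  intro c hc
  exact ⟨fun i => ⟨c i, hF c hc i⟩, rfl⟩

theorem inner_eq_tsum {n : ℕ} (v w : Fermi n) :
    ⟪v, w⟫_ℂ = ∑' c, star (coeff v c) * coeff w c := by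
  rw [Submodule.coe_inner, lp.inner_eq_tsum]
  refine tsum_congr fun c => ?_
  rw [RCLike.inner_apply, mul_comm]
  rfl

/-- The Fourier coefficients with momenta in `K`. -/
def coeffOn (K : Finset Lattice) {n : ℕ} (v : Fermi n) (c : Fin n → K) : ℂ :=
  coeff v fun i => (c i : Lattice)

theorem coeffOn_antisymm (K : Finset Lattice) {n : ℕ} (v : Fermi n) (σ : Equiv.Perm (Fin n))
    (c : Fin n → K) :
    coeffOn K v (fun i => c (σ i)) = ((Equiv.Perm.sign σ : ℤ) : ℂ) * coeffOn K v c :=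
  coeff_antisymm v σ fun i => (c i : Lattice)

theorem coe_snoc {K : Finset Lattice} {n : ℕ} (d : Fin n → K) (k : K) :
    (fun i => ((Fin.snoc d k : Fin (n + 1) → K) i : Lattice)) =
      (Fin.snoc (fun i => (d i : Lattice)) (k : Lattice) : Config (n + 1)) :=
  Fin.comp_snoc (fun z : K => (z : Lattice)) d k

theorem norm_sq_eq_sum {n : ℕ} {K : Finset Lattice} {v : Fermi n}
    (hK : ∀ c, coeff v c ≠ 0 → ∀ i, c i ∈ K) : ‖v‖ ^ 2 = ∑ c, ‖coeffOn K v c‖ ^ 2 := by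
  rw [← (hasSum_norm_sq v).tsum_eq]
  exact tsum_config_eq fun c hc => hK c fun h => hc (by simp [h])

namespace Model

variable (S : Model)

theorem inner_funPT {n : ℕ} {K : Finset Lattice} (f : Plane → ℝ → ℝ) (v : finDom n)
    (hK : ∀ c, coeff (v : Fermi n) c ≠ 0 → ∀ i, c i ∈ K) :
    ⟪(v : Fermi n), (funPT S.L f v : Fermi n)⟫_ℂ =
      ((∑ c : Fin n → K, f (totalMom S.L fun i => (c i : Lattice))
        (kinetic S.L fun i => (c i : Lattice)) * ‖coeffOn K (v : Fermi n) c‖ ^ 2 : ℝ) : ℂ) := by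
  rw [inner_eq_tsum]
  have e : ∀ c, star (coeff (v : Fermi n) c) * coeff (funPT S.L f v : Fermi n) c =
      ((f (totalMom S.L c) (kinetic S.L c) * ‖coeff (v : Fermi n) c‖ ^ 2 : ℝ) : ℂ) := by
    intro c
    have e1 : coeff (funPT S.L f v : Fermi n) c =
      (f (totalMom S.L c) (kinetic S.L c) : ℂ) * coeff (v : Fermi n) c := rfl
    have e2 : ((‖coeff (v : Fermi n) c‖ : ℝ) : ℂ) ^ 2 =
      star (coeff (v : Fermi n) c) * coeff (v : Fermi n) c := (RCLike.conj_mul _).symm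
    rw [e1]
    push_cast
    rw [e2]
    ring
  simp only [e]
  rw [tsum_config_eq (K := K)]
  · push_cast
    rfl
  · intro c hc
    exact hK c fun h => hc (by simp [h])

theorem inner_Pterm {n : ℕ} {K : Finset Lattice} (lam : ℝ) (p k l : Lattice) (v : finDom (n + 1))
    (hK : ∀ c, coeff (v : Fermi (n + 1)) c ≠ 0 → ∀ i, c i ∈ K) :
    ⟪(v : Fermi (n + 1)), S.Pterm lam p k l v⟫_ℂ = ((n : ℂ) + 1) * ∑ d : Fin n → K,
      star (coeff (v : Fermi (n + 1)) (Fin.snoc (fun i => (d i : Lattice)) l)) *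
        coeff (v : Fermi (n + 1)) (Fin.snoc (fun i => (d i : Lattice)) k) *
        ((S.resolvent lam p k l (totalMom S.L fun i => (d i : Lattice))
          (kinetic S.L fun i => (d i : Lattice)) : ℝ) : ℂ) := by
  have e0 : S.Pterm lam p k l v =
      create l (funPT S.L (S.resolvent lam p k l) (annihFin k v) : Fermi n) := rfl
  rw [e0, create, ContinuousLinearMap.adjoint_inner_right, inner_eq_tsum]
  have hn : (0 : ℝ) ≤ (n : ℝ) + 1 := by positivity
  have hsq : ((√((n : ℝ) + 1) : ℝ) : ℂ) * ((√((n : ℝ) + 1) : ℝ) : ℂ) = (n : ℂ) + 1 := by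
    rw [← Complex.ofReal_mul, Real.mul_self_sqrt hn]
    push_cast
    rfl
  have e : ∀ d : Config n, star (coeff (annih l (v : Fermi (n + 1))) d) *
      coeff (funPT S.L (S.resolvent lam p k l) (annihFin k v) : Fermi n) d =
      ((n : ℂ) + 1) * (star (coeff (v : Fermi (n + 1)) (Fin.snoc d l)) *
        coeff (v : Fermi (n + 1)) (Fin.snoc d k) *
        ((S.resolvent lam p k l (totalMom S.L d) (kinetic S.L d) : ℝ) : ℂ)) := by
    intro d
    have e1 : coeff (funPT S.L (S.resolvent lam p k l) (annihFin k v) : Fermi n) d =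
      ((S.resolvent lam p k l (totalMom S.L d) (kinetic S.L d) : ℝ) : ℂ) *
        (((√((n : ℝ) + 1) : ℝ) : ℂ) * coeff (v : Fermi (n + 1)) (Fin.snoc d k)) := rfl
    have e2 : coeff (annih l (v : Fermi (n + 1))) d =
      ((√((n : ℝ) + 1) : ℝ) : ℂ) * coeff (v : Fermi (n + 1)) (Fin.snoc d l) := rfl
    rw [e1, e2, star_mul', RCLike.star_def, Complex.conj_ofReal, ← hsq]
    ring
  simp only [e]
  rw [tsum_config_eq (K := K), Finset.mul_sum]
  intro d hd i
  have h1 : coeff (v : Fermi (n + 1)) (Fin.snoc d k) ≠ 0 := by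
    intro h
    exact hd (by simp [h])
  have h2 := hK _ h1 (Fin.castSucc i)
  simpa using h2

open Classical in
theorem inner_P {n : ℕ} {K : Finset Lattice} (lam : ℝ) (p : Lattice) (v : finDom (n + 1))
    (hK : ∀ c, coeff (v : Fermi (n + 1)) c ≠ 0 → ∀ i, c i ∈ K) :
    ⟪(v : Fermi (n + 1)), S.P lam p (n + 1) v⟫_ℂ = ((1 / S.L ^ 2 : ℝ) : ℂ) * (((n : ℂ) + 1) *
      ∑ d : Fin n → K, ∑ k ∈ Finset.univ.filter fun k : K => S.mu < ‖S.k k‖ ^ 2,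
        ∑ l ∈ Finset.univ.filter fun k : K => S.mu < ‖S.k k‖ ^ 2,
        star (coeffOn K (v : Fermi (n + 1)) (Fin.snoc d l)) *
        coeffOn K (v : Fermi (n + 1)) (Fin.snoc d k) *
        ((S.resolvent lam p k l (totalMom S.L fun i => (d i : Lattice))
          (kinetic S.L fun i => (d i : Lattice)) : ℝ) : ℂ)) := by
  set A : Finset K := Finset.univ.filter fun k : K => S.mu < ‖S.k k‖ ^ 2 with hA
  have e0 : S.P lam p (n + 1) v = ((1 / S.L ^ 2 : ℝ) : ℂ) •
        ∑' q : S.particles × S.particles, S.Pterm lam p q.1 q.2 v := rfl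
  have e1 : ⟪(v : Fermi (n + 1)), ∑' q : S.particles × S.particles, S.Pterm lam p q.1 q.2 v⟫_ℂ =
      ∑' q : S.particles × S.particles, ⟪(v : Fermi (n + 1)), S.Pterm lam p q.1 q.2 v⟫_ℂ :=
    (innerSL ℂ (v : Fermi (n + 1))).map_tsum (S.summable_Pterm lam p v)
  rw [e0]
  refine (inner_smul_right (𝕜 := ℂ) (v : Fermi (n + 1)) _ _).trans ?_
  rw [e1]
  congr 1
  simp only [S.inner_Pterm lam p _ _ v hK]
  rw [tsum_mul_left]
  congr 1
  set g : A × A → S.particles × S.particles := fun q =>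
    (⟨(q.1 : K), (Finset.mem_filter.1 q.1.2).2⟩, ⟨(q.2 : K), (Finset.mem_filter.1 q.2.2).2⟩) with hg
  have hinj : Function.Injective g := by
    rintro ⟨⟨a, _⟩, ⟨b, _⟩⟩ ⟨⟨a', _⟩, ⟨b', _⟩⟩ h
    simp only [hg, Prod.mk.injEq, Subtype.mk.injEq] at h ⊢
    have h1 : (a : Lattice) = a' := congrArg (fun y : S.particles => (y : Lattice)) h.1
    have h2 : (b : Lattice) = b' := congrArg (fun y : S.particles => (y : Lattice)) h.2
    exact ⟨Subtype.ext h1, Subtype.ext h2⟩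
  rw [← hinj.tsum_eq, tsum_fintype, Fintype.sum_prod_type]
  · have e2 : ∀ (d : Fin n → K) (k : K),
        coeff (v : Fermi (n + 1)) (Fin.snoc (fun i => (d i : Lattice)) (k : Lattice)) =
        coeffOn K (v : Fermi (n + 1)) (Fin.snoc d k) := by
      intro d k
      rw [coeffOn, coe_snoc]
    simp only [hg, e2]
    rw [Finset.sum_comm' (s := Finset.univ) (t := fun _ => A) (t' := A) (s' := fun _ => Finset.univ)
      (by simp)]
    rw [← Finset.sum_coe_sort A]
    refine Finset.sum_congr rfl fun k _ => ?_
    rw [Finset.sum_comm' (s := Finset.univ) (t := fun _ => A) (t' := A) (s' := fun _ => Finset.univ)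
      (by simp)]
    rw [← Finset.sum_coe_sort A]
  -- A nonzero summand forces `k` and `l`, as last momenta of configurations in the support, to lie
  -- in `K`.
  · rintro ⟨⟨k, hk⟩, ⟨l, hl⟩⟩ hq
    obtain ⟨d, _, hd⟩ := Finset.exists_ne_zero_of_sum_ne_zero hq
    have h1 := hK _ (right_ne_zero_of_mul (left_ne_zero_of_mul hd)) (Fin.last n)
    have h2 := hK _ (star_ne_zero.1 (left_ne_zero_of_mul (left_ne_zero_of_mul hd))) (Fin.last n)
    simp only [Fin.snoc_last] at h1 h2
    exact ⟨(⟨⟨k, h1⟩, Finset.mem_filter.2 ⟨Finset.mem_univ _, hk⟩⟩,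
      ⟨⟨l, h2⟩, Finset.mem_filter.2 ⟨Finset.mem_univ _, hl⟩⟩), rfl⟩

/-! ## Kinetic energy of configurations -/

theorem N_eq : S.N = (S.ball S.mu).card := by
  have h : S.holes = (S.ball S.mu : Set Lattice) := by
    ext z
    exact S.mem_ball.symm
  rw [N, h, Set.ncard_coe_finset]

theorem E0_eq : S.E0 = ∑ z ∈ S.ball S.mu, ‖S.k z‖ ^ 2 :=
  finsum_mem_eq_finite_toFinset_sum _ (S.finite_norm_k_sq_le S.mu)

/-- Bathtub principle: among sets of distinct momenta the Fermi ball minimises `∑ (k² - μ)`, because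
it collects all nonpositive terms. Injectivity of `c` is the Pauli principle. -/
theorem le_kinetic {n : ℕ} {c : Config n} (hc : Function.Injective c) :
    S.E0 + ((n : ℝ) - S.N) * S.mu + ∑ i, max (‖S.k (c i)‖ ^ 2 - S.mu) 0 ≤ kinetic S.L c := by
  classical
  set s : Finset Lattice := Finset.univ.image c with hs
  have hsum : ∀ g : Lattice → ℝ, ∑ i, g (c i) = ∑ z ∈ s, g z := fun g => by
    rw [hs, Finset.sum_image hc.injOn]
  have hk : kinetic S.L c - n * S.mu = ∑ z ∈ s, (‖S.k z‖ ^ 2 - S.mu) := by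
    rw [← hsum, Finset.sum_sub_distrib]
    simp [kinetic]
  have hE : S.E0 - S.N * S.mu = ∑ z ∈ S.ball S.mu, (‖S.k z‖ ^ 2 - S.mu) := by
    rw [Finset.sum_sub_distrib, ← E0_eq, N_eq]
    simp
  have hmin : ∑ z ∈ S.ball S.mu, (‖S.k z‖ ^ 2 - S.mu) ≤ ∑ z ∈ s, min (‖S.k z‖ ^ 2 - S.mu) 0 := by
    have h1 : ∑ z ∈ S.ball S.mu ∪ s, min (‖S.k z‖ ^ 2 - S.mu) 0 ≤
        ∑ z ∈ s, min (‖S.k z‖ ^ 2 - S.mu) 0 := by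
      rw [← Finset.sum_sdiff (Finset.subset_union_right : s ⊆ S.ball S.mu ∪ s)]
      exact add_le_of_nonpos_left (Finset.sum_nonpos fun z _ => min_le_right _ _)
    refine le_trans (le_of_eq ?_) h1
    rw [← Finset.sum_sdiff (Finset.subset_union_left : S.ball S.mu ⊆ S.ball S.mu ∪ s),
      Finset.sum_eq_zero (s := _ \ _), zero_add]
    · refine Finset.sum_congr rfl fun z hz => (min_eq_left ?_).symm
      linarith [S.mem_ball.1 hz]
    · intro z hz
      refine min_eq_right ?_
      have := (Finset.mem_sdiff.1 hz).2
      rw [mem_ball, not_le] at this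
      linarith
  have hsplit : ∑ z ∈ s, (‖S.k z‖ ^ 2 - S.mu) = ∑ z ∈ s, min (‖S.k z‖ ^ 2 - S.mu) 0 +
      ∑ z ∈ s, max (‖S.k z‖ ^ 2 - S.mu) 0 := by
    rw [← Finset.sum_add_distrib]
    refine Finset.sum_congr rfl fun z _ => ?_
    rw [min_add_max, add_zero]
  rw [hsum fun z => max (‖S.k z‖ ^ 2 - S.mu) 0]
  linarith

theorem kinetic_snoc {n : ℕ} (L : ℝ) (d : Config n) (k : Lattice) :
    kinetic L (Fin.snoc d k : Config (n + 1)) = kinetic L d + ‖mom L k‖ ^ 2 := by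
  rw [kinetic, Fin.sum_univ_castSucc]
  simp [kinetic]

/-- This holds even without solutions of the polaron equation, since the real `sInf` of an empty or
unbounded set is 0. -/
theorem eP_nonpos : S.eP ≤ 0 := Real.sInf_nonpos fun _ h => h.1.le

end Model

/-! ## Lower bound on `P_p(λ)` -/

/-- The exponential is dominated by an inverse square: for `y ≥ 2m`, `t (A + y)/8 = 1 + t (m + y)/8
≤ 1 + t (y - m)/2 ≤ exp(t (y - m)/2)` with `A = 8/t + m`. Squaring reduces the claim to the basic
lattice sum. -/
theorem sum_exp_neg_le {L m t : ℝ} (hL : 0 < L) (hm : 1 ≤ L ^ 2 * m) (ht : 0 < t) {ι : Type*}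
    (z : ι → Lattice) (hz : Function.Injective z) (H : Finset ι)
    (hH : ∀ k ∈ H, 2 * m ≤ ‖mom L (z k)‖ ^ 2) :
    ∑ k ∈ H, Real.exp (-t * (‖mom L (z k)‖ ^ 2 - m)) ≤ 32 * L ^ 2 / t := by
  classical
  have hm0 : 0 < m := by
    by_contra h
    nlinarith [sq_nonneg L]
  set A : ℝ := 8 / t + m with hA
  have h8 : 0 < 8 / t := by positivity
  have hpt : ∀ k ∈ H, Real.exp (-t * (‖mom L (z k)‖ ^ 2 - m)) ≤
      64 / t ^ 2 * (1 / (A + ‖mom L (z k)‖ ^ 2) ^ 2) := by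
    intro k hk
    have hk2 := hH k hk
    set y := ‖mom L (z k)‖ ^ 2 with hy
    have h1 : t / 8 * (A + y) ≤ Real.exp (t * (y - m) / 2) := by
      refine le_trans ?_ (Real.add_one_le_exp _)
      have e : t / 8 * (A + y) = 1 + t * (m + y) / 8 := by
        rw [hA]
        field_simp
        ring
      rw [e]
      nlinarith
    have h2 := pow_le_pow_left₀ (by positivity) h1 2
    rw [← Real.exp_nat_mul] at h2
    have e2 : Real.exp (-t * (y - m)) = 1 / Real.exp (((2 : ℕ) : ℝ) * (t * (y - m) / 2)) := by
      rw [one_div, ← Real.exp_neg]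
      congr 1
      push_cast
      ring
    rw [e2]
    refine (one_div_le_one_div_of_le (by positivity) h2).trans (le_of_eq ?_)
    field_simp
    ring
  refine (Finset.sum_le_sum hpt).trans ?_
  rw [← Finset.mul_sum, ← Finset.sum_image (s := H) (g := z) (f := fun y : Lattice =>
        1 / (A + ‖mom L y‖ ^ 2) ^ 2) hz.injOn]
  have h3 := sum_inv_norm_mom_sq_le hL (A := A)
    (hm.trans (mul_le_mul_of_nonneg_left (by linarith) (by positivity))) (H.image z)
  have h4 : 4 * L ^ 2 / A ≤ 4 * L ^ 2 / (8 / t) :=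
    div_le_div_of_nonneg_left (by positivity) h8 (by linarith)
  refine (mul_le_mul_of_nonneg_left (h3.trans h4) (by positivity)).trans (le_of_eq ?_)
  field_simp
  ring

theorem integral_exp_div_sqrt {η : ℝ} (hη : 0 < η) :
    IntegrableOn (fun t : ℝ => t ^ ((1 : ℝ) / 2 - 1) * Real.exp (-(η * t))) (Set.Ioi 0) ∧
    ∫ t in Set.Ioi (0 : ℝ), t ^ ((1 : ℝ) / 2 - 1) * Real.exp (-(η * t)) = √(Real.pi / η) := by
  have h := Real.integral_rpow_mul_exp_neg_mul_Ioi (a := 1 / 2) (r := η) (by norm_num) hη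
  constructor
  -- The integral of a non-integrable function is 0 by convention, which contradicts the positive
  -- value of the Gamma integral.
  · by_contra hc
    rw [integral_undef hc] at h
    have : 0 < (1 / η) ^ ((1 : ℝ) / 2) * Real.Gamma (1 / 2) :=
      mul_pos (by positivity) (Real.Gamma_pos_of_pos (by norm_num))
    linarith
  · rw [h, Real.Gamma_one_half_eq, ← Real.sqrt_eq_rpow, ← Real.sqrt_mul (by positivity)]
    congr 1
    ring

namespace Model

variable (S : Model)

/-- Measuring both momenta from the Fermi level moves `2μ` to the remaining `N(μ) - 2` particles,
for which `T - λ + 2μ ≥ 0`. -/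
theorem resolvent_eq (lam : ℝ) (p k l : Lattice) (P : Plane) (T : ℝ) :
    S.resolvent lam p k l P T = 1 / ((T - lam + 2 * S.mu) + (‖S.k k‖ ^ 2 - S.mu) +
      (‖S.k l‖ ^ 2 - S.mu) + 1 / S.M * ‖(S.k p - P) - S.k k - S.k l‖ ^ 2) := by
  rw [resolvent]
  congr 1
  ring

theorem resolvent_comm (lam : ℝ) (p k l : Lattice) (P : Plane) (T : ℝ) :
    S.resolvent lam p k l P T = S.resolvent lam p l k P T := by
  rw [resolvent, resolvent, sub_right_comm]
  congr 1
  ring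

/-- The resolvent is real and symmetric in `k` and `l`, so conjugation only exchanges the two
summation variables. -/
theorem im_inner_P {n : ℕ} (lam : ℝ) (p : Lattice) (v : finDom (n + 1)) :
    (⟪(v : Fermi (n + 1)), S.P lam p (n + 1) v⟫_ℂ).im = 0 := by
  classical
  obtain ⟨K, hK⟩ := exists_finset_momenta v.2
  rw [S.inner_P lam p v hK, ← Complex.conj_eq_iff_im, map_mul, map_mul, Complex.conj_ofReal,
    map_sum]
  have hn : (starRingEnd ℂ) ((n : ℂ) + 1) = (n : ℂ) + 1 := by simp
  rw [hn]
  congr 2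
  refine Finset.sum_congr rfl fun d _ => ?_
  rw [map_sum, Finset.sum_comm]
  simp only [map_sum]
  refine Finset.sum_congr rfl fun k _ => Finset.sum_congr rfl fun l _ => ?_
  rw [S.resolvent_comm lam p k l, map_mul, map_mul, Complex.conj_ofReal, RCLike.star_def,
    Complex.conj_conj]
  ring

/-- The form splits into four blocks according to whether `k` and `l` lie below or above `D μ`. The
low-low block gives `μ/η`, each mixed block half of the square-root term, and the high-high block
the constant. -/
theorem neg_le_re_inner_P (hM : 1 < S.M) (hLmu : 1 ≤ S.L ^ 2 * S.mu) {n : ℕ} (hN : S.N = n + 2)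
    {lam : ℝ} (hlam : lam ≤ S.E0) (p : Lattice) {η : ℝ} (hη : 0 < η) (v : finDom (n + 1))
    (hv : ∀ c, coeff (v : Fermi (n + 1)) c ≠ 0 → ∃ i, S.mu + η ≤ ‖S.k (c i)‖ ^ 2) :
    -((4 * (1 + 2 * S.M / (S.M - 1)) ^ 2 * (S.mu / η) +
        42 * (1 + 2 * S.M / (S.M - 1)) * √(S.mu / η) +
        64 * S.M / (S.M - 1) ^ 2) * ‖(v : Fermi (n + 1))‖ ^ 2) ≤
      (⟪(v : Fermi (n + 1)), S.P lam p (n + 1) v⟫_ℂ).re := by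
  classical
  have hL := S.L_pos
  have hmu0 := S.mu_pos
  have hM0 := S.M_pos
  have hM1 : 0 < S.M - 1 := by linarith
  obtain ⟨K, hK⟩ := exists_finset_momenta v.2
  set D : ℝ := 2 * S.M / (S.M - 1) with hD
  have hD2 : 2 ≤ D := by
    rw [hD, le_div_iff₀ hM1]
    linarith
  set w : (Fin (n + 1) → K) → ℂ := coeffOn K (v : Fermi (n + 1)) with hw
  have hwa : ∀ (σ : Equiv.Perm (Fin (n + 1))) c,
      w (fun i => c (σ i)) = ((Equiv.Perm.sign σ : ℤ) : ℂ) * w c :=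
    coeffOn_antisymm K (v : Fermi (n + 1))
  set W : ℝ := ∑ c, ‖w c‖ ^ 2 with hW
  have hvW : ‖(v : Fermi (n + 1))‖ ^ 2 = W := norm_sq_eq_sum hK
  have hW0 : 0 ≤ W := Finset.sum_nonneg fun _ _ => by positivity
  set X : (Fin (n + 1) → K) → ℝ := fun c =>
    kinetic S.L (fun i => (c i : Lattice)) - lam + S.mu with hX
  set Y : (Fin n → K) → ℝ := fun d =>
    kinetic S.L (fun i => (d i : Lattice)) - lam + 2 * S.mu with hY
  set q : (Fin n → K) → Plane := fun d => S.k p - totalMom S.L fun i => (d i : Lattice) with hq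
  set kap : K → ℝ := fun k => ‖S.k k‖ ^ 2 - S.mu with hkap
  have hXσ : ∀ (σ : Equiv.Perm (Fin (n + 1))) c, X (fun i => c (σ i)) = X c := by
    intro σ c
    have : kinetic S.L (fun i => ((c (σ i) : K) : Lattice)) =
        kinetic S.L (fun i => (c i : Lattice)) :=
      Equiv.sum_comp σ fun i => ‖mom S.L (c i : Lattice)‖ ^ 2
    simp only [hX, this]
  have hXY : ∀ d k, X (Fin.snoc d k) = Y d + kap k := by
    intro d k
    simp only [hX, hY, hkap, coe_snoc, kinetic_snoc]
    ring
  have hinj : ∀ c, w c ≠ 0 → Function.Injective fun i => (c i : Lattice) := by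
    intro c hc
    by_contra h
    exact hc (eq_zero_of_not_injective (coeff_antisymm (v : Fermi (n + 1))) h)
  -- There are `n + 1 = N(μ) - 1` particles, so `le_kinetic` has a deficit of exactly `μ`, which is
  -- the shift in `X`. In `hY0` one particle fewer gives `2μ`, the shift in `Y`.
  have hXle : ∀ c, w c ≠ 0 → ∑ i, max (kap (c i)) 0 ≤ X c := by
    intro c hc
    have h1 := S.le_kinetic (hinj c hc)
    rw [hN] at h1
    push_cast at h1
    simp only [hX, hkap]
    linarith
  have hηX : ∀ c, w c ≠ 0 → η ≤ X c := by
    intro c hc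
    obtain ⟨i, hi⟩ := hv _ hc
    have h1 : max (kap (c i)) 0 ≤ ∑ i, max (kap (c i)) 0 :=
      Finset.single_le_sum (f := fun i => max (kap (c i)) 0) (fun _ _ => le_max_right _ _)
        (Finset.mem_univ i)
    have h2 : η ≤ max (kap (c i)) 0 := le_max_of_le_left (by simp only [hkap]; linarith)
    exact h2.trans (h1.trans (hXle c hc))
  have hY0 : ∀ d k, w (Fin.snoc d k) ≠ 0 → 0 ≤ Y d := by
    intro d k hdk
    have h1 := hinj _ hdk
    rw [coe_snoc] at h1
    have h2 : Function.Injective fun i => (d i : Lattice) := by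
      intro i j hij
      have := @h1 (Fin.castSucc i) (Fin.castSucc j) (by simpa using hij)
      exact Fin.castSucc_injective _ this
    have h3 := S.le_kinetic h2
    rw [hN] at h3
    push_cast at h3
    have h4 : 0 ≤ ∑ i, max (‖S.k (d i)‖ ^ 2 - S.mu) 0 :=
      Finset.sum_nonneg fun _ _ => le_max_right _ _
    simp only [hY]
    linarith
  set A : Finset K := Finset.univ.filter fun k : K => S.mu < ‖S.k k‖ ^ 2 with hA
  set Lo : Finset K := A.filter fun k : K => ‖S.k k‖ ^ 2 ≤ D * S.mu with hLo
  set Hi : Finset K := A.filter fun k : K => ¬ ‖S.k k‖ ^ 2 ≤ D * S.mu with hHi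
  have hkA : ∀ k ∈ A, 0 ≤ kap k := by
    intro k hk
    have := (Finset.mem_filter.1 hk).2
    simp only [hkap]
    linarith
  have hkLo : ∀ k ∈ Lo, 0 ≤ kap k := fun k hk => hkA k (Finset.mem_filter.1 hk).1
  have hkHi : ∀ k ∈ Hi, 0 ≤ kap k := fun k hk => hkA k (Finset.mem_filter.1 hk).1
  have hHiD : ∀ k ∈ Hi, D * S.mu ≤ ‖mom S.L (k : Lattice)‖ ^ 2 := fun k hk =>
    (not_le.1 (Finset.mem_filter.1 hk).2).le
  set B : Finset K → Finset K → ℂ := fun U V => ∑ d : Fin n → K, ∑ k ∈ U, ∑ l ∈ V,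
    star (w (Fin.snoc d l)) * w (Fin.snoc d k) *
    ((1 / (Y d + kap k + kap l + 1 / S.M * ‖q d - S.k k - S.k l‖ ^ 2) : ℝ) : ℂ) with hB
  have hsplit : B A A = B Lo Lo + B Lo Hi + B Hi Lo + B Hi Hi := by
    simp only [hB]
    rw [← Finset.sum_add_distrib, ← Finset.sum_add_distrib, ← Finset.sum_add_distrib]
    refine Finset.sum_congr rfl fun d _ => ?_
    rw [← Finset.sum_filter_add_sum_filter_not A (fun k : K => ‖S.k k‖ ^ 2 ≤ D * S.mu),
      add_assoc (_ + _), ← Finset.sum_add_distrib, ← Finset.sum_add_distrib]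
    congr 1 <;>
    · refine Finset.sum_congr rfl fun k _ => ?_
      rw [← Finset.sum_filter_add_sum_filter_not A (fun k : K => ‖S.k k‖ ^ 2 ≤ D * S.mu)]
  have hcard : (Lo.card : ℝ) ≤ 4 * (1 + D) ^ 2 * (S.L ^ 2 * S.mu) := by
    rw [← Finset.card_map (Function.Embedding.subtype _)]
    refine card_mom_le hL hLmu (by linarith) _ fun z hz => ?_
    obtain ⟨k, hk, rfl⟩ := Finset.mem_map.1 hz
    exact (Finset.mem_filter.1 hk).2
  have hLosum : ∀ t, 0 < t → ∑ k ∈ Lo, Real.exp (-t * kap k) ≤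
      4 * (1 + D) ^ 2 * (S.L ^ 2 * S.mu) := by
    intro t ht
    refine le_trans (Finset.sum_le_sum (g := fun _ => (1 : ℝ)) fun k hk => ?_) ?_
    · rw [Real.exp_le_one_iff]
      nlinarith [hkLo k hk]
    · simpa using hcard
  have hHisum : ∀ t, 0 < t → ∑ k ∈ Hi, Real.exp (-t * kap k) ≤ 32 * S.L ^ 2 / t := by
    intro t ht
    exact sum_exp_neg_le hL hLmu ht (fun k : K => (k : Lattice)) Subtype.coe_injective Hi
      fun k hk => le_trans (mul_le_mul_of_nonneg_right hD2 hmu0.le) (hHiD k hk)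
  set c₁ : ℝ := 4 * (1 + D) ^ 2 * (S.L ^ 2 * S.mu) with hc₁
  have hc₁0 : 0 ≤ c₁ := by positivity
  have hLL : ((n : ℝ) + 1) * ‖B Lo Lo‖ ≤ S.L ^ 2 * (4 * (1 + D) ^ 2 * (S.mu / η)) * W := by
    have h := norm_resolvent_form_le (fun k : K => S.k k) kap Lo Lo hM0 q Y X hXσ hXY hwa hη hηX
      hkLo (b := fun t => Real.exp (-t * η) * c₁) ((integrableOn_exp_neg_mul_Ioi hη).mul_const _)
      (fun t ht => by
        refine mul_le_mul_of_nonneg_left ?_ (by positivity)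
        rw [Real.mul_self_sqrt (Finset.sum_nonneg fun _ _ => by positivity)]
        exact hLosum t ht)
    rw [integral_mul_const, integral_exp_neg_mul_Ioi hη] at h
    refine h.trans (le_of_eq ?_)
    rw [hc₁]
    ring
  have hmix : ∀ t, 0 < t → Real.exp (-t * η) * (√(∑ k ∈ Lo, Real.exp (-t * kap k)) *
      √(∑ k ∈ Hi, Real.exp (-t * kap k))) ≤
      √(c₁ * (32 * S.L ^ 2)) * (t ^ ((1 : ℝ) / 2 - 1) * Real.exp (-(η * t))) := by
    intro t ht
    have h1 : √(∑ k ∈ Lo, Real.exp (-t * kap k)) * √(∑ k ∈ Hi, Real.exp (-t * kap k)) ≤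
        √c₁ * √(32 * S.L ^ 2 / t) :=
      mul_le_mul (Real.sqrt_le_sqrt (hLosum t ht)) (Real.sqrt_le_sqrt (hHisum t ht))
        (Real.sqrt_nonneg _) (Real.sqrt_nonneg _)
    have h2 : t ^ ((1 : ℝ) / 2 - 1) = (√t)⁻¹ := by
      rw [Real.sqrt_eq_rpow, ← Real.rpow_neg ht.le]
      norm_num
    rw [h2, show -t * η = -(η * t) by ring]
    refine (mul_le_mul_of_nonneg_left h1 (by positivity)).trans (le_of_eq ?_)
    rw [Real.sqrt_mul hc₁0, Real.sqrt_div (by positivity)]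
    ring
  have hmixint : ∫ t in Set.Ioi (0 : ℝ),
      √(c₁ * (32 * S.L ^ 2)) * (t ^ ((1 : ℝ) / 2 - 1) * Real.exp (-(η * t))) ≤
      S.L ^ 2 * (21 * (1 + D) * √(S.mu / η)) := by
    rw [integral_const_mul, (integral_exp_div_sqrt hη).2, ← Real.sqrt_mul (by positivity)]
    have hpi := Real.pi_lt_d2
    -- After squaring, the claim reduces to `4 · 32 · π = 128 π ≤ 441 = 21²`.
    rw [Real.sqrt_le_left (by positivity), mul_pow, mul_pow, Real.sq_sqrt (by positivity), hc₁]
    have e : 4 * (1 + D) ^ 2 * (S.L ^ 2 * S.mu) * (32 * S.L ^ 2) * (Real.pi / η) =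
        128 * Real.pi * ((S.L ^ 2) ^ 2 * ((1 + D) ^ 2 * (S.mu / η))) := by
      field_simp
      ring
    rw [e]
    have h0 : 0 ≤ (S.L ^ 2) ^ 2 * ((1 + D) ^ 2 * (S.mu / η)) := by positivity
    nlinarith
  have hLH : ((n : ℝ) + 1) * ‖B Lo Hi‖ ≤ S.L ^ 2 * (21 * (1 + D) * √(S.mu / η)) * W := by
    have h := norm_resolvent_form_le (fun k : K => S.k k) kap Lo Hi hM0 q Y X hXσ hXY hwa hη hηX
      hkHi ((integral_exp_div_sqrt hη).1.const_mul _) hmix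
    exact h.trans (mul_le_mul_of_nonneg_right hmixint hW0)
  have hHL : ((n : ℝ) + 1) * ‖B Hi Lo‖ ≤ S.L ^ 2 * (21 * (1 + D) * √(S.mu / η)) * W := by
    have h := norm_resolvent_form_le (fun k : K => S.k k) kap Hi Lo hM0 q Y X hXσ hXY hwa hη hηX
      hkLo ((integral_exp_div_sqrt hη).1.const_mul _)
      (fun t ht => by rw [mul_comm (√_)]; exact hmix t ht)
    exact h.trans (mul_le_mul_of_nonneg_right hmixint hW0)
  have hHH : -(64 * S.M / (S.M - 1) ^ 2 * S.L ^ 2 * W) ≤ ((n : ℝ) + 1) * (B Hi Hi).re := by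
    refine neg_le_re_sum_high hM hL hLmu (fun k : K => (k : Lattice)) Subtype.coe_injective Hi
      hHiD q Y X hXσ hXY hwa hY0 fun c hc => ?_
    refine le_trans (Finset.sum_le_sum fun i _ => ?_) (hXle c hc)
    by_cases hi : c i ∈ Hi
    · rw [Set.indicator_of_mem (by exact_mod_cast hi)]
      exact le_max_left _ _
    · rw [Set.indicator_of_notMem (by exact_mod_cast hi)]
      exact le_max_right _ _
  have hP : ⟪(v : Fermi (n + 1)), S.P lam p (n + 1) v⟫_ℂ =
      ((1 / S.L ^ 2 : ℝ) : ℂ) * ((((n : ℝ) + 1 : ℝ) : ℂ) * B A A) := by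
    rw [S.inner_P lam p v hK]
    simp only [S.resolvent_eq]
    have hn : (((n : ℝ) + 1 : ℝ) : ℂ) = (n : ℂ) + 1 := by push_cast; ring
    rw [hn]
  rw [hP, Complex.re_ofReal_mul, Complex.re_ofReal_mul, hsplit, hvW]
  simp only [Complex.add_re]
  have hn : 0 ≤ (n : ℝ) + 1 := by positivity
  have r : ∀ z : ℂ, -(((n : ℝ) + 1) * ‖z‖) ≤ ((n : ℝ) + 1) * z.re := by
    intro z
    rw [← mul_neg]
    exact mul_le_mul_of_nonneg_left (abs_le.1 (Complex.abs_re_le_norm z)).1 hn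
  have r1 := r (B Lo Lo)
  have r2 := r (B Lo Hi)
  have r3 := r (B Hi Lo)
  have hL2 : 0 < S.L ^ 2 := by positivity
  rw [one_div_mul_eq_div, le_div_iff₀ hL2]
  linarith

end Model

/-! ## Positivity of `Ψ_p(λ, ε)` -/

/-- Nonnegativity is a closed condition on pairs `(w, A w)`, hence passes to the closure of the
graph. For a non-closable operator `closure` is the operator itself. -/
theorem opNonneg_closure {H : Type*} [NormedAddCommGroup H] [InnerProductSpace ℂ H]
    {A : H →ₗ.[ℂ] H} (hA : OpNonneg A) : OpNonneg A.closure := by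
  by_cases hc : A.IsClosable
  · intro w
    have hmem : ((w : H), A.closure w) ∈ closure (A.graph : Set (H × H)) := by
      have h := A.closure.mem_graph w
      rw [← hc.graph_closure_eq_closure_graph] at h
      exact h
    have hcl : IsClosed {q : H × H | 0 ≤ (⟪q.1, q.2⟫_ℂ).re ∧ (⟪q.1, q.2⟫_ℂ).im = 0} := by
      have h : Continuous fun q : H × H => ⟪q.1, q.2⟫_ℂ := continuous_fst.inner continuous_snd
      exact (isClosed_le continuous_const (Complex.continuous_re.comp h)).inter
        (isClosed_eq (Complex.continuous_im.comp h) continuous_const)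
    refine closure_minimal (fun q hq => ?_) hcl hmem
    obtain ⟨y, hy1, hy2⟩ := A.mem_graph_iff.1 hq
    have := hA y
    rw [hy1, hy2] at this
    exact this
  · rw [LinearPMap.closure_def' hc]
    exact hA

namespace Model

variable (S : Model)

theorem inner_PiPerp_left {ε : ℝ} {n : ℕ} (v w : Fermi n) :
    ⟪S.PiPerp ε v, w⟫_ℂ = ⟪v, S.PiPerp ε w⟫_ℂ := by
  classical
  rw [inner_eq_tsum, inner_eq_tsum]
  refine tsum_congr fun c => ?_
  have e : ∀ u : Fermi n, coeff (S.PiPerp ε u) c = if S.HasHighMode ε c then coeff u c else 0 :=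
    fun u => by
      change (if S.HasHighMode ε c then coeff u c else 0) = _
      congr
  rw [e, e]
  split_ifs <;> simp

theorem hasHighMode_of_coeff_PiPerp_ne {ε : ℝ} {n : ℕ} {v : Fermi n} {c : Config n}
    (h : coeff (S.PiPerp ε v) c ≠ 0) : S.HasHighMode ε c := by
  classical
  by_contra hc
  apply h
  change (if S.HasHighMode ε c then coeff v c else 0) = 0
  rw [if_neg hc]

/-- Without particles there is no high mode, so `Π_ε^⊥ = 0`. -/
theorem opNonneg_Psi₀_zero (lam ε : ℝ) (p : Lattice) : OpNonneg (S.Psi₀ lam ε p 0) := by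
  have h0 : ∀ x : Fermi 0, S.PiPerp ε x = 0 := by
    intro x
    apply coeff_ext
    funext c
    by_contra h
    obtain ⟨i, _⟩ := S.hasHighMode_of_coeff_PiPerp_ne h
    exact i.elim0
  intro w
  have e : S.Psi₀ lam ε p 0 w = 0 := h0 _
  rw [e]
  simp

/-- `Ψ_p(λ, ε) ≥ 0` on finite linear combinations, if the lower bound on `G` outweighs the lower
bound on `P_p(λ)`. -/
theorem opNonneg_Psi₀ (hM : 1 < S.M) (hE : 1 ≤ S.L ^ 2 * |S.EB|) (hmu : |S.EB| ≤ S.mu) {n : ℕ}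
    (hN : S.N = n + 2) {lam ε : ℝ} (hlam : lam ≤ S.E0) (p : Lattice)
    (hε : 0 < ε * Real.log S.muTilde)
    (hK : S.K ε + 36 * (ε * Real.log S.muTilde) + (64 + 64 * (8 + 2 * S.M) ^ 3 / S.M ^ 2) +
      (4 * (1 + 2 * S.M / (S.M - 1)) ^ 2 * (ε * Real.log S.muTilde) +
        42 * (1 + 2 * S.M / (S.M - 1)) * √(ε * Real.log S.muTilde) +
        64 * S.M / (S.M - 1) ^ 2) ≤
      1 / (4 * Real.pi ^ 2 * (2 * (1 + 1 / S.M) + 1)) *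
        (Real.log S.muTilde / 2 - Real.log 8)) :
    OpNonneg (S.Psi₀ lam ε p (n + 1)) := by
  intro w
  have hmu0 := S.mu_pos
  have hLmu : 1 ≤ S.L ^ 2 * S.mu := hE.trans (mul_le_mul_of_nonneg_left hmu (by positivity))
  set v : finDom (n + 1) := S.PiPerpFin ε w with hv
  -- `η` is the width of the shell in the definition of `Π_ε`, hence the minimal energy excess of a
  -- configuration in the range of `Π_ε^⊥`.
  set η : ℝ := S.mu / (ε * Real.log S.muTilde) with hη
  have hη0 : 0 < η := by positivity
  have hmuη : S.mu / η = ε * Real.log S.muTilde := by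
    rw [hη]
    field_simp
  have hsupp : ∀ c, coeff (v : Fermi (n + 1)) c ≠ 0 → ∃ i, S.mu + η ≤ ‖S.k (c i)‖ ^ 2 := by
    intro c hc
    obtain ⟨i, hi⟩ := S.hasHighMode_of_coeff_PiPerp_ne (v := (w : Fermi (n + 1))) hc
    refine ⟨i, le_of_eq_of_le ?_ hi.le⟩
    rw [hη]
    ring
  have hP := S.neg_le_re_inner_P hM hLmu hN hlam p hη0 v hsupp
  have hPim := S.im_inner_P lam p v
  obtain ⟨K, hKs⟩ := exists_finset_momenta v.2
  have hGin := S.inner_funPT (fun P T => S.G (S.k p - P) (T - lam)) v hKs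
  have hnorm := norm_sq_eq_sum hKs
  set g : ℝ := 1 / (4 * Real.pi ^ 2 * (2 * (1 + 1 / S.M) + 1)) *
        (Real.log S.muTilde / 2 - Real.log 8) - 36 * (S.mu / η) -
        (64 + 64 * (8 + 2 * S.M) ^ 3 / S.M ^ 2) with hg
  have hG : g * ‖(v : Fermi (n + 1))‖ ^ 2 ≤
      ∑ c : Fin (n + 1) → K, S.G (S.k p - totalMom S.L fun i => (c i : Lattice))
        ((kinetic S.L fun i => (c i : Lattice)) - lam) *
        ‖coeffOn K (v : Fermi (n + 1)) c‖ ^ 2 := by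
    rw [hnorm, Finset.mul_sum]
    refine Finset.sum_le_sum fun c _ => ?_
    by_cases hc : coeffOn K (v : Fermi (n + 1)) c = 0
    · simp [hc]
    refine mul_le_mul_of_nonneg_right (S.le_G hE hmu _ hη0 ?_) (by positivity)
    have hinj : Function.Injective fun i => (c i : Lattice) := by
      by_contra h
      exact hc (eq_zero_of_not_injective (coeff_antisymm (v : Fermi (n + 1))) h)
    have h1 := S.le_kinetic hinj
    obtain ⟨i, hi⟩ := hsupp _ hc
    have h2 : max (‖S.k (c i)‖ ^ 2 - S.mu) 0 ≤ ∑ i, max (‖S.k (c i)‖ ^ 2 - S.mu) 0 :=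
      Finset.single_le_sum (f := fun i => max (‖S.k (c i)‖ ^ 2 - S.mu) 0)
        (fun _ _ => le_max_right _ _) (Finset.mem_univ i)
    have h3 : ‖S.k (c i)‖ ^ 2 - S.mu ≤ max (‖S.k (c i)‖ ^ 2 - S.mu) 0 := le_max_left _ _
    rw [hN] at h1
    push_cast at h1
    linarith
  have e : ⟪(w : Fermi (n + 1)), S.Psi₀ lam ε p (n + 1) w⟫_ℂ =
      ⟪(v : Fermi (n + 1)), (funPT S.L (fun P T => S.G (S.k p - P) (T - lam)) v : Fermi (n + 1))⟫_ℂ +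
      ⟪(v : Fermi (n + 1)), S.P lam p (n + 1) v⟫_ℂ -
      ((S.K ε * ‖(v : Fermi (n + 1))‖ ^ 2 : ℝ) : ℂ) := by
    have e1 : S.Psi₀ lam ε p (n + 1) w = S.PiPerp ε
      ((funPT S.L (fun P T => S.G (S.k p - P) (T - lam)) v : Fermi (n + 1)) +
        S.P lam p (n + 1) v - ((S.K ε : ℝ) : ℂ) • (v : Fermi (n + 1))) := rfl
    have e2 : (v : Fermi (n + 1)) = S.PiPerp ε (w : Fermi (n + 1)) := rfl
    rw [e1, ← inner_PiPerp_left, ← e2, inner_sub_right, inner_add_right]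
    congr 1
    refine (inner_smul_right (𝕜 := ℂ) (v : Fermi (n + 1)) _ _).trans ?_
    rw [inner_self_eq_norm_sq_to_K]
    push_cast
    rfl
  rw [e, hGin]
  constructor
  · rw [Complex.sub_re, Complex.add_re, Complex.ofReal_re, Complex.ofReal_re]
    have h0 : 0 ≤ (g - (4 * (1 + 2 * S.M / (S.M - 1)) ^ 2 * (S.mu / η) +
        42 * (1 + 2 * S.M / (S.M - 1)) * √(S.mu / η) +
        64 * S.M / (S.M - 1) ^ 2) - S.K ε) * ‖(v : Fermi (n + 1))‖ ^ 2 := by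
      refine mul_nonneg ?_ (by positivity)
      rw [hg, hmuη]
      linarith
    linarith
  · rw [Complex.sub_im, Complex.add_im, Complex.ofReal_im, Complex.ofReal_im, hPim]
    simp

end Model

/-! ### Choice of `ε₀` and `c₀` -/

theorem exists_le_mul_of_sqrt {α β γ : ℝ} (hα : 0 < α) (hβ : 0 ≤ β) :
    ∃ ℓ₀ : ℝ, 1 ≤ ℓ₀ ∧ ∀ ℓ, ℓ₀ ≤ ℓ → β + γ * √ℓ ≤ α * ℓ := by
  refine ⟨max 1 (((β + γ) / α) ^ 2), le_max_left _ _, fun ℓ hℓ => ?_⟩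
  have h1 : 1 ≤ ℓ := (le_max_left _ _).trans hℓ
  have h2 := (le_max_right _ _).trans hℓ
  have h3 : 1 ≤ √ℓ := Real.one_le_sqrt.2 h1
  have h4 : (β + γ) / α ≤ √ℓ := Real.le_sqrt_of_sq_le h2
  rw [div_le_iff₀ hα] at h4
  have h5 := mul_le_mul_of_nonneg_right h4 (Real.sqrt_nonneg ℓ)
  rw [mul_right_comm, Real.mul_self_sqrt (by linarith)] at h5
  nlinarith

end FermiPolaron

end

theorem mainTheorem3 (M : ℝ) (hM : 1.225 < M) :
    ∃ ε₀ : ℝ, 0 < ε₀ ∧ ∀ ε : ℝ, 0 < ε → ε < ε₀ →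
      ∃ c₀ : ℝ, 0 < c₀ ∧ ∀ S : FermiPolaron.Model, S.M = M →
        1 ≤ S.L ^ 2 * |S.EB| → c₀ ≤ S.mu / |S.EB| →
        ∀ lam : ℝ, lam ≤ S.E0 + S.eP → ∀ p : FermiPolaron.Lattice,
          FermiPolaron.OpNonneg (S.Psi lam ε p) := by
  have hM1 : 1 < M := by linarith
  have hM0 : 0 < M - 1 := by linarith
  have hM00 : 0 < M := by linarith
  have hpi := Real.pi_pos
  set c₁ : ℝ := 1 / (4 * Real.pi ^ 2 * (2 * (1 + 1 / M) + 1)) with hc₁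
  have hc₁0 : 0 < c₁ := by positivity
  set D : ℝ := 1 + 2 * M / (M - 1) with hD
  have hD0 : 0 < D := by positivity
  -- `A √ε log μ̃` collects all terms linear in `log μ̃`: 36 from `G`, `4 D²` from the low-low block
  -- of `P_p(λ)`, and 1 from `K`. The leading term is `(c₁/2) log μ̃`; the definition of `r`
  -- reserves one half of it for these terms.
  set A : ℝ := 37 + 4 * D ^ 2 with hA
  have hA0 : 0 < A := by positivity
  set r : ℝ := min 1 (c₁ / (4 * A)) with hr
  have hr0 : 0 < r := lt_min one_pos (by positivity)
  refine ⟨r ^ 2, by positivity, fun ε hε hεr => ?_⟩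
  set s : ℝ := √ε with hs
  have hs0 : 0 < s := Real.sqrt_pos.2 hε
  have hsε : s ^ 2 = ε := Real.sq_sqrt hε.le
  have hsr : s < r := lt_of_pow_lt_pow_left₀ 2 hr0.le (by rw [hsε]; exact hεr)
  have hs1 : s ≤ 1 := hsr.le.trans (min_le_left _ _)
  have hsA : A * s ≤ c₁ / 4 := by
    have h1 := hsr.le.trans (min_le_right _ _)
    rw [le_div_iff₀ (by positivity)] at h1
    linarith
  set C : ℝ := c₁ * Real.log 8 + (64 + 64 * (8 + 2 * M) ^ 3 / M ^ 2) + 64 * M / (M - 1) ^ 2 +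
    1 / ε with hC
  have hlog8 : 0 ≤ Real.log 8 := Real.log_nonneg (by norm_num)
  have hC0 : 0 ≤ C := by positivity
  -- The other half of `(c₁/2) log μ̃` absorbs, for large `log μ̃`, the constants and the terms of
  -- order `√(log μ̃)`.
  obtain ⟨ℓ₀, hℓ₀, hℓ⟩ := FermiPolaron.exists_le_mul_of_sqrt (α := c₁ / 4) (β := C)
    (γ := 42 * D + 1 / s) (by positivity) hC0
  refine ⟨Real.exp ℓ₀, Real.exp_pos _, fun S hSM hE hmu lam hlam p => ?_⟩
  have hEB : 0 < |S.EB| := abs_pos.2 S.EB_neg.ne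
  have hmu1 : |S.EB| ≤ S.mu := by
    have : 1 ≤ S.mu / |S.EB| := le_trans (Real.one_le_exp (by linarith)) hmu
    rwa [le_div_iff₀ hEB, one_mul] at this
  set ℓ : ℝ := Real.log S.muTilde with hℓdef
  have hℓℓ : ℓ₀ ≤ ℓ := (Real.le_log_iff_exp_le ((Real.exp_pos _).trans_le hmu)).2 hmu
  have hℓ1 : 1 ≤ ℓ := hℓ₀.trans hℓℓ
  have hlamE : lam ≤ S.E0 := by linarith [S.eP_nonpos]
  refine FermiPolaron.opNonneg_closure ?_
  rcases Nat.lt_or_ge S.N 2 with hN | hN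
  -- The subtraction is truncated, so both `N = 0` and `N = 1` lead to the space without particles.
  · rw [show S.N - 1 = 0 by omega]
    exact S.opNonneg_Psi₀_zero lam ε p
  obtain ⟨n, hn⟩ := Nat.exists_eq_add_of_le' hN
  rw [show S.N - 1 = n + 1 by omega]
  refine S.opNonneg_Psi₀ (by rw [hSM]; exact hM1) hE hmu1 hn hlamE p (by positivity) ?_
  rw [hSM, ← hℓdef, ← hD, ← hc₁]
  have hKe : S.K ε = 1 / ε + 1 / s * √ℓ + s * ℓ := by
    rw [FermiPolaron.Model.K, ← hs, ← hℓdef, ← hsε]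
    field_simp
  have hsq : √(ε * ℓ) ≤ √ℓ := by
    refine Real.sqrt_le_sqrt ?_
    have : ε ≤ 1 := by
      rw [← hsε]
      exact pow_le_one₀ hs0.le hs1
    nlinarith
  have hεs : ε * ℓ ≤ s * ℓ := by
    refine mul_le_mul_of_nonneg_right ?_ (by linarith)
    rw [← hsε]
    nlinarith
  have h1 := hℓ ℓ hℓℓ
  have h2 := mul_le_mul_of_nonneg_right hsA (by linarith : 0 ≤ ℓ)
  have h3 := mul_le_mul_of_nonneg_left hsq (by positivity : 0 ≤ 42 * D)
  have h4 := mul_le_mul_of_nonneg_left hεs (by positivity : 0 ≤ 36 + 4 * D ^ 2)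
  rw [hKe]
  rw [hA] at h2
  rw [hC] at h1
  linarith
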